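/- Let $K\ge 0$, $n=2K+1$, and write $j'=n+1-j$ for $1\le j\le n$. Let $c>0$, $0<\zeta_1<\dots<\zeta_K$, $b_1,\dots,b_K>0$ and masses $m_1,\dots,m_n>0$ be given. Suppose that for all odd $k$ with $1\le k\le 2K-1$ $$\frac{1}{m_{(k+1)'}m_{k'}}<\frac{\zeta_1^{(k+1)/2}}{\zeta_K^{(k-1)/2}}\min\{1,\hat\beta\},\qquad \frac{1}{m_{(k+2)'}m_{(k+1)'}}<\frac{\zeta_1^{(k+1)/2}}{\zeta_K^{(k-1)/2}}\min\{1,\hat\beta_1\},$$ where $\hat\beta=+\infty$ for $k=1$, $$\hat\beta=\frac{2\zeta_K\,\min_j(\zeta_{j+1}-\zeta_j)^{k-3}}{\zeta_1(k-1)(\zeta_K-\zeta_1)^{k-1}}\cdot\frac{(1+m_{k'}^2\zeta_1)(1+m_{(k+1)'}^2\zeta_1)}{m_{k'}^2m_{(k+1)'}^2}\qquad(3\le k\le 2K-1),$$ $$\hat\beta_1=\frac{2\,\min_j(\zeta_{j+1}-\zeta_j)^{k-1}}{(k+1)(\zeta_K-\zeta_1)^{k+1}}\cdot\frac{(1+m_{(k+1)'}^2\zeta_1)(1+m_{(k+2)'}^2\zeta_1)}{m_{(k+1)'}^2m_{(k+2)'}^2}$$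 (the minima are over $1\le j\le K-1$), and $\hat\beta_1=+\infty$ if $K=1$. For $t\in\mathbb R$ put $b_j(t)=b_je^{2t/\zeta_j}$, $e_j=1/m_{j'}^2$, $F(y)=c+\sum_{j=1}^K\frac{b_j(t)}{y+\zeta_j}$, and let $\mathcal D_k^{(l,p)}$ be the absolute value of the determinant of the $k\times k$ matrix with rows $$\big(e_i^{p}F(e_i),\,e_i^{p+1}F(e_i),\dots,e_i^{p+l-1}F(e_i),\,1,\,e_i,\dots,e_i^{k-l-1}\big),\quad 1\le i\le k,\qquad \mathcal D_0^{(l,p)}=1.$$ Define the positions $x_1(t),\dots,x_n(t)$ by $$x_{k'}=\ln\frac{e_1\cdots e_{k-1}\,\mathcal D_k^{(\frac{k+1}2,0)}\mathcal D_{k-1}^{(\frac{k-1}2,0)}}{m_{k'}\,\mathcal D_k^{(\frac{k-1}2,1)}\mathcal D_{k-1}^{(\frac{k-1}2,1)}}\ (k\text{ odd}),\qquad x_{k'}=\ln\frac{e_1\cdots e_{k-1}\,\mathcal D_k^{(\frac k2,0)}\mathcal D_{k-1}^{(\frac k2,0)}}{m_{k'}\,\mathcal D_k^{(\frac k2,1)}\mathcal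 D_{k-1}^{(\frac k2-1,1)}}\ (k\text{ even})$$ if the masses are pairwise distinct, and by the continuous extension of these formulas (in the masses) otherwise. Then these positions are well defined, and $x_1(t)<x_2(t)<\dots<x_{2K+1}(t)$ for every $t\in\mathbb R$. The multipeakon solution exists for all $t\in\mathbb R$: the positions satisfy $$\dot x_j=2\sum_{k\ne j}m_jm_ke^{-|x_j-x_k|}+4\sum_{i<j<k}m_im_ke^{-|x_i-x_k|},\qquad 1\le j\le n,\quad t\in\mathbb R,$$ and $u(x,t)=\sum_{j=1}^{2K+1}m_je^{-|x-x_j(t)|}$ solves the modified Camassa–Holm equation $m_t+\big((u^2-\langle u_x^2\rangle)m\big)_x=0$, $m=u-u_{xx}$, for all $t\in\mathbb R$, in the sense of distributions in $x$, where $\langle u_x^2\rangle$ is the arithmetic mean of the left and right limits of $u_x^2$. That is, $m(\cdot,t)$ is a locally finite positive measure and $\frac{d}{dt}\int\psi\,dm(\cdot,t)=\int(u^2-\langle u_x^2\rangle)\psi_x\,dm(\cdot,t)$ for all smooth compactly supported $\psi$. -/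

import Mathlib

namespace MCH

open Filter Topology MeasureTheory

/-! All families `m`, `x`, `ζ`, `b`, `e` are indexed from `1`, as functions on `ℕ` of which only the
entries `m 1, …, m n`, `x 1, …, x n`, `ζ 1, …, ζ K`, `b 1, …, b K`, `e 1, …, e n` are relevant. -/

/-! ### The multipeakon system and the mCH equation -/

/-- The index reflection `k ↦ k' = n + 1 - k` of `{1, …, n}`. -/
def prime (n k : ℕ) : ℕ := n + 1 - k

/-- The right-hand side of the peakon equations
`ẋ_j = 2 ∑_{k ≠ j} m_j m_k e^{-|x_j - x_k|} + 4 ∑_{i < j < k} m_i m_k e^{-|x_i - x_k|}`. -/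
noncomputable def velocity (n : ℕ) (m x : ℕ → ℝ) (j : ℕ) : ℝ :=
  2 * ∑ k ∈ (Finset.Icc 1 n).erase j, m j * m k * Real.exp (-|x j - x k|) +
    4 * ∑ i ∈ Finset.Ico 1 j, ∑ k ∈ Finset.Ioc j n, m i * m k * Real.exp (-|x i - x k|)

/-- The peakon ansatz `u(y) = ∑_j m_j e^{-|y - x_j|}`. -/
noncomputable def peakonProfile (n : ℕ) (m x : ℕ → ℝ) (y : ℝ) : ℝ :=
  ∑ j ∈ Finset.Icc 1 n, m j * Real.exp (-|y - x j|)

/-- Test functions: smooth and compactly supported. -/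
def IsTest (ψ : ℝ → ℝ) : Prop :=
  ContDiff ℝ (⊤ : ℕ∞) ψ ∧ HasCompactSupport ψ

/-- `f - f_{xx} = μ` in the sense of distributions. -/
def IsMomentum (f : ℝ → ℝ) (μ : Measure ℝ) : Prop :=
  ∀ ψ : ℝ → ℝ, IsTest ψ → ∫ y, f y * (ψ y - deriv (deriv ψ) y) = ∫ y, ψ y ∂μ

/-- `a = ⟨f_x²⟩(y)`: the arithmetic mean of the left and right limits of `f_x²` at `y`
(both of which are required to exist). -/
def IsMeanSqDeriv (f : ℝ → ℝ) (y a : ℝ) : Prop :=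
  (∀ᶠ z in 𝓝[≠] y, DifferentiableAt ℝ f z) ∧
    ∃ l r : ℝ, Tendsto (fun z => deriv f z ^ 2) (𝓝[<] y) (𝓝 l) ∧
      Tendsto (fun z => deriv f z ^ 2) (𝓝[>] y) (𝓝 r) ∧ a = (l + r) / 2

/-- `u(y, t)` solves `m_t + ((u² - ⟨u_x²⟩) m)_x = 0`, `m = u - u_{xx}`, for all `t ∈ ℝ`, in the
sense of distributions in the space variable: for every time, `m` is a positive, locally finite
measure `μ t`, and `d/dt ⟨m, ψ⟩ = ⟨(u² - ⟨u_x²⟩) m, ψ_x⟩` for all test functions `ψ`. -/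
structure IsSolution (u : ℝ → ℝ → ℝ) : Prop where
  continuous : ∀ t, Continuous fun y => u y t
  equation : ∃ (μ : ℝ → Measure ℝ) (v : ℝ → ℝ → ℝ),
    (∀ t, IsLocallyFiniteMeasure (μ t)) ∧
    (∀ t, IsMomentum (fun y => u y t) (μ t)) ∧
    (∀ t y, IsMeanSqDeriv (fun z => u z t) y (v y t)) ∧
    ∀ ψ : ℝ → ℝ, IsTest ψ → ∀ t,
      Integrable (fun y => (u y t ^ 2 - v y t) * deriv ψ y) (μ t) ∧
      HasDerivAt (fun s => ∫ y, ψ y ∂(μ s))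
        (∫ y, (u y t ^ 2 - v y t) * deriv ψ y ∂(μ t)) t

/-! ### The inverse formulas -/

/-- `e_j = 1 / m_{j'}²`. -/
noncomputable def nodes (n : ℕ) (m : ℕ → ℝ) (j : ℕ) : ℝ := 1 / m (prime n j) ^ 2

/-- The shifted Stieltjes transform `c + ∫ dμ(x) / (y + x)` of `μ = ∑_{j=1}^K b_j δ_{ζ_j}`. -/
noncomputable def stieltjes (K : ℕ) (ζ b : ℕ → ℝ) (c y : ℝ) : ℝ :=
  c + ∑ j ∈ Finset.Icc 1 K, b j / (y + ζ j)

/-- The Cauchy–Stieltjes–Vandermonde matrix `CSV_k^{(l,p)}(e, ν, c)`, where `F` is the shifted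
Stieltjes transform of `ν`; its `i`-th row is
`e_i^p F(e_i), e_i^{p+1} F(e_i), …, e_i^{p+l-1} F(e_i), 1, e_i, …, e_i^{k-l-1}`. -/
noncomputable def csv (e : ℕ → ℝ) (F : ℝ → ℝ) (k l p : ℕ) : Matrix (Fin k) (Fin k) ℝ :=
  Matrix.of fun i j =>
    if (j : ℕ) < l then e (i + 1) ^ (p + (j : ℕ)) * F (e (i + 1))
    else e (i + 1) ^ ((j : ℕ) - l)

/-- `𝒟_k^{(l,p)} = |det CSV_k^{(l,p)}(e, μ, c)|` for `n = 2K + 1` (in particular `𝒟_0 = 1`). -/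
noncomputable def detCSV (K : ℕ) (m ζ b : ℕ → ℝ) (c : ℝ) (k l p : ℕ) : ℝ :=
  |(csv (nodes (2 * K + 1) m) (stieltjes K ζ b c) k l p).det|

/-- The explicit inverse formula for the position `x_{k'}`, `n = 2K + 1`, for distinct masses. -/
noncomputable def inverseFormula (K : ℕ) (m ζ b : ℕ → ℝ) (c : ℝ) (k : ℕ) : ℝ :=
  if Odd k then
    Real.log (((∏ j ∈ Finset.Icc 1 (k - 1), nodes (2 * K + 1) m j) *
        detCSV K m ζ b c k ((k + 1) / 2) 0 * detCSV K m ζ b c (k - 1) ((k - 1) / 2) 0) /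
      (m (prime (2 * K + 1) k) *
        detCSV K m ζ b c k ((k - 1) / 2) 1 * detCSV K m ζ b c (k - 1) ((k - 1) / 2) 1))
  else
    Real.log (((∏ j ∈ Finset.Icc 1 (k - 1), nodes (2 * K + 1) m j) *
        detCSV K m ζ b c k (k / 2) 0 * detCSV K m ζ b c (k - 1) (k / 2) 0) /
      (m (prime (2 * K + 1) k) *
        detCSV K m ζ b c k (k / 2) 1 * detCSV K m ζ b c (k - 1) (k / 2 - 1) 1))

/-- Families of positive and pairwise distinct masses `m_1, …, m_n`. -/
def distinctMasses (n : ℕ) : Set (ℕ → ℝ) :=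
  {m | (∀ j ∈ Set.Icc 1 n, 0 < m j) ∧ Set.InjOn m (Set.Icc 1 n)}

/-- `y` is the position `x_{k'}` given by the inverse formula, extended continuously from distinct
masses to all positive masses.  If the masses `m` are themselves distinct, this forces
`y = inverseFormula K m ζ b c k` (see `IsPosition.eq_inverseFormula`). -/
def IsPosition (K : ℕ) (m ζ b : ℕ → ℝ) (c : ℝ) (k : ℕ) (y : ℝ) : Prop :=
  Tendsto (fun m' => inverseFormula K m' ζ b c k) (𝓝[distinctMasses (2 * K + 1)] m) (𝓝 y)

theorem IsPosition.eq_inverseFormula {K : ℕ} {m ζ b : ℕ → ℝ} {c : ℝ} {k : ℕ} {y : ℝ}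
    (h : IsPosition K m ζ b c k y) (hm : m ∈ distinctMasses (2 * K + 1)) :
    y = inverseFormula K m ζ b c k := by
  have h1 : Tendsto (fun m' => inverseFormula K m' ζ b c k) (pure m) (𝓝 y) :=
    h.mono_left (pure_le_nhdsWithin hm)
  exact tendsto_nhds_unique h1 (tendsto_pure_nhds _ _)

/-! ### The quantities in the sufficient conditions -/

/-- `min_j (ζ_{j+1} - ζ_j)`, `1 ≤ j ≤ K - 1`; used for `K ≥ 2` only. -/
noncomputable def minGap (K : ℕ) (ζ : ℕ → ℝ) : ℝ :=
  sInf ((fun j => ζ (j + 1) - ζ j) '' Set.Icc 1 (K - 1))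

/-- `ζ_1^{(k+1)/2} / ζ_K^{(k-1)/2}` for odd `k`. -/
noncomputable def alpha (K : ℕ) (ζ : ℕ → ℝ) (k : ℕ) : ℝ :=
  ζ 1 ^ ((k + 1) / 2) / ζ K ^ ((k - 1) / 2)

/-- `β̂` (for odd `k`), equal to `+∞` for `k = 1`. -/
noncomputable def betaHat (K : ℕ) (m ζ : ℕ → ℝ) (k : ℕ) : EReal :=
  if k = 1 then ⊤ else
    (((2 * ζ K * minGap K ζ ^ (k - 3)) / (ζ 1 * ((k : ℝ) - 1) * (ζ K - ζ 1) ^ (k - 1)) *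
      (((1 + m (prime (2 * K + 1) k) ^ 2 * ζ 1) * (1 + m (prime (2 * K + 1) (k + 1)) ^ 2 * ζ 1)) /
        (m (prime (2 * K + 1) k) ^ 2 * m (prime (2 * K + 1) (k + 1)) ^ 2)) : ℝ) : EReal)

/-- `β̂₁` (for odd `k`).  For `K = 1` the denominator contains `ζ_K - ζ_1 = 0`, and the value is
`+∞`. -/
noncomputable def betaHatOne (K : ℕ) (m ζ : ℕ → ℝ) (k : ℕ) : EReal :=
  if K = 1 then ⊤ else
    (((2 * minGap K ζ ^ (k - 1)) / (((k : ℝ) + 1) * (ζ K - ζ 1) ^ (k + 1)) *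
      (((1 + m (prime (2 * K + 1) (k + 1)) ^ 2 * ζ 1) *
          (1 + m (prime (2 * K + 1) (k + 2)) ^ 2 * ζ 1)) /
        (m (prime (2 * K + 1) (k + 1)) ^ 2 * m (prime (2 * K + 1) (k + 2)) ^ 2)) : ℝ) : EReal)

end MCH

/-! The peakons are recovered from `F = Q / P` one at a time, from the right. For the rightmost
peakon put `h = m e^x` and `g = m e^{-x}`, so that `e g h = 1` with `e = 1 / m²`. The relations `Q =
Q₁ + h P₁`, `P = P₁ + g y Q₁` describe how it is attached to the remaining ones, and polynomial
solvability forces `h = Q(e) / P(e)`. Hence `h` and the shorter pair `(P₁, Q₁)` are determined by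
`F`; iteration yields all positions.

Positivity. `F` is a Stieltjes function: `-Q/P` and `y Q/P` both have positive kernels. Removing a
peakon turns a combination of these kernels into its Schur complement at `e`, so the class is
preserved (`IsStage.strip`), together with positivity on `(-σ, ∞)`, where `σ = ζ₁` if `K ≥ 1`.

Ordering. Evaluating the shorter function just inside the spectral gap, at `-τ` with `0 < τ < σ`,
bounds the next value of `h` by `e h / τ` (`IsStage.quot_strip_lt`). Therefore `1 / (m_j m_{j+1}) <
ζ₁` implies `x_j < x_{j+1}`, and the assumed inequalities contain this bound for every `j`.

Inverse formulas. For distinct masses, column operations on the determinants reproduce one removal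
step (`detRatio_succ`, `quot_stage_eq_detRatio`). The removal procedure also makes sense for
coinciding masses and is continuous in them, so it computes the continuous extension.

Dynamics. The flow `b_j e^{2t/ζ_j}` is a linear evolution of `(P, Q)` with coefficients depending on
`H = Q(0)/P(0)`. Each removal preserves its form and adds `g` to a parameter `Γ` (`Evolves.strip`).
As `H` sums the remaining `h` and `Γ` the removed `g`, the logarithmic derivative of `h` is the
peakon velocity. For ordered peakons this velocity is `u² - ⟨u_x²⟩` at `x_j`, which gives the
distributional equation. -/

namespace MCH

open Filter Topology Polynomial

/-! ### Kernels that are sums of squares of polynomials -/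

/-- A kernel of the form `∑ᵢ uᵢ(x) uᵢ(y)` with polynomials `uᵢ`. -/
def IsSqKernel (k : ℝ → ℝ → ℝ) : Prop :=
  ∃ (ι : Type) (_ : Fintype ι) (u : ι → ℝ[X]), ∀ x y, k x y = ∑ i, (u i).eval x * (u i).eval y

namespace IsSqKernel

variable {k k₁ k₂ : ℝ → ℝ → ℝ}

theorem zero : IsSqKernel fun _ _ => 0 :=
  ⟨Empty, inferInstance, fun _ => 0, fun x y => by simp⟩

theorem add (h₁ : IsSqKernel k₁) (h₂ : IsSqKernel k₂) :
    IsSqKernel fun x y => k₁ x y + k₂ x y := by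
  obtain ⟨ι, _, u, hu⟩ := h₁
  obtain ⟨κ, _, v, hv⟩ := h₂
  exact ⟨ι ⊕ κ, inferInstance, Sum.elim u v, fun x y => by simp [hu, hv]⟩

theorem sq_mul (h : IsSqKernel k) (p : ℝ[X]) :
    IsSqKernel fun x y => p.eval x * p.eval y * k x y := by
  obtain ⟨ι, _, u, hu⟩ := h
  refine ⟨ι, inferInstance, fun i => p * u i, fun x y => ?_⟩
  simp only [hu, eval_mul, Finset.mul_sum]
  exact Finset.sum_congr rfl fun i _ => by ring

theorem const_mul (h : IsSqKernel k) {a : ℝ} (ha : 0 ≤ a) : IsSqKernel fun x y => a * k x y := by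
  have := h.sq_mul (C (Real.sqrt a))
  simpa [Real.mul_self_sqrt ha] using this

theorem of_mul (p : ℝ[X]) : IsSqKernel fun x y => p.eval x * p.eval y :=
  ⟨Unit, inferInstance, fun _ => p, fun x y => by simp⟩

theorem sum {σ : Type*} (s : Finset σ) {f : σ → ℝ → ℝ → ℝ} (h : ∀ i ∈ s, IsSqKernel (f i)) :
    IsSqKernel fun x y => ∑ i ∈ s, f i x y := by
  classical
  induction s using Finset.induction_on with
  | empty => simpa using zero
  | insert a s ha ih =>
    simp only [Finset.sum_insert ha]
    exact (h a (by simp)).add (ih fun i hi => h i (by simp [hi]))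

theorem symm (h : IsSqKernel k) (x y : ℝ) : k x y = k y x := by
  obtain ⟨ι, _, u, hu⟩ := h
  simp only [hu, mul_comm]

theorem exists_polynomial (h : IsSqKernel k) (x : ℝ) : ∃ p : ℝ[X], ∀ y, k x y = p.eval y := by
  obtain ⟨ι, _, u, hu⟩ := h
  exact ⟨∑ i, C ((u i).eval x) * u i, fun y => by simp [hu, eval_finsetSum]⟩

theorem differentiable (h : IsSqKernel k) (x : ℝ) : Differentiable ℝ (k x) := by
  obtain ⟨p, hp⟩ := h.exists_polynomial x
  rw [show k x = fun y => p.eval y from funext hp]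
  exact p.differentiable

theorem continuous_left (h : IsSqKernel k) (y : ℝ) : Continuous fun x => k x y := by
  simp_rw [fun x => h.symm x y]
  exact (h.differentiable y).continuous

theorem self_nonneg (h : IsSqKernel k) (x : ℝ) : 0 ≤ k x x := by
  obtain ⟨ι, _, u, hu⟩ := h
  rw [hu]
  exact Finset.sum_nonneg fun i _ => mul_self_nonneg _

/-- All `uᵢ` vanish at `x` when the sum of their squares does. This is the source of strict
inequalities: a degenerate diagonal value would kill a whole row of the kernel. -/
theorem eq_zero_of_self_eq_zero (h : IsSqKernel k) {x : ℝ} (hx : k x x = 0) (y : ℝ) :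
    k x y = 0 := by
  obtain ⟨ι, _, u, hu⟩ := h
  rw [hu] at hx ⊢
  rw [Finset.sum_eq_zero_iff_of_nonneg fun i _ => mul_self_nonneg _] at hx
  exact Finset.sum_eq_zero fun i hi => by rw [mul_self_eq_zero.1 (hx i hi), zero_mul]

/-- The Schur complement of a kernel at a point `e`, divided by `(x - e) (y - e)`. -/
theorem schur (h : IsSqKernel k) {e : ℝ} (he : k e e ≠ 0) :
    ∃ k' : ℝ → ℝ → ℝ, IsSqKernel k' ∧
      ∀ x y, (x - e) * (y - e) * k' x y = k x y - k x e * k y e / k e e := by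
  obtain ⟨ι, _, u, hu⟩ := id h
  obtain ⟨r, hr⟩ := h.exists_polynomial e
  -- Projecting the vector `(uᵢ)` orthogonally to its value at `e` makes every component vanish at
  -- `e`; the quotients `w i` by `X - e` form the new kernel.
  have hroot : ∀ i, (u i - C ((u i).eval e / k e e) * r).IsRoot e := by
    intro i
    simp only [IsRoot, eval_sub, eval_mul, eval_C, ← hr]
    field_simp
    ring
  choose w hw using fun i => dvd_iff_isRoot.2 (hroot i)
  refine ⟨_, ⟨ι, inferInstance, w, fun x y => rfl⟩, fun x y => ?_⟩
  have hev : ∀ i z, (z - e) * (w i).eval z = (u i).eval z - (u i).eval e / k e e * k z e := by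
    intro i z
    have := congrArg (eval z) (hw i)
    simp only [eval_sub, eval_mul, eval_C, eval_X, ← hr] at this
    rw [← this, h.symm z e]
  have hexp : ∀ i, (x - e) * (y - e) * ((w i).eval x * (w i).eval y) =
      (u i).eval x * (u i).eval y - k y e / k e e * ((u i).eval x * (u i).eval e)
        - k x e / k e e * ((u i).eval y * (u i).eval e)
        + k x e * k y e / k e e ^ 2 * ((u i).eval e * (u i).eval e) := by
    intro i
    rw [show (x - e) * (y - e) * ((w i).eval x * (w i).eval y) =
      ((x - e) * (w i).eval x) * ((y - e) * (w i).eval y) by ring, hev, hev]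
    ring
  rw [Finset.mul_sum, Finset.sum_congr rfl fun i _ => hexp i]
  simp only [Finset.sum_add_distrib, Finset.sum_sub_distrib, ← Finset.mul_sum, ← hu]
  field_simp
  ring

end IsSqKernel

/-- Identities involving division by `y - e` are checked by cancellation off `e` and extended by
density. -/
theorem eq_of_eqOn_compl {f g : ℝ → ℝ} (hf : Continuous f) (hg : Continuous g) {e : ℝ}
    (h : ∀ x, x ≠ e → f x = g x) (x : ℝ) : f x = g x :=
  congrFun (Continuous.ext_on (dense_compl_singleton e) hf hg fun _ hx => h _ hx) x

/-! ### Removing the rightmost peakon -/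

/-- `h = Q(e) / P(e)`. -/
noncomputable def quot (e : ℝ) (s : ℝ[X] × ℝ[X]) : ℝ := s.2.eval e / s.1.eval e

/-- The pair `(P₁, Q₁)` with `Q = Q₁ + h P₁`, `P = P₁ + g y Q₁`, where `h = Q(e) / P(e)` and
`g = 1 / (e h)`. -/
noncomputable def strip (e : ℝ) (s : ℝ[X] × ℝ[X]) : ℝ[X] × ℝ[X] :=
  (C (-e) * ((s.1 - C (1 / (e * quot e s)) * (X * s.2)) /ₘ (X - C e)),
    C (-e) * ((s.2 - C (quot e s) * s.1) /ₘ (X - C e)))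

section strip

variable {e : ℝ} {s : ℝ[X] × ℝ[X]}

/-- The division is exact: `g e Q(e) = Q(e) / h = P(e)`. -/
theorem strip_fst_mul (he : e ≠ 0) (hP : s.1.eval e ≠ 0) (hQ : s.2.eval e ≠ 0) :
    (X - C e) * (strip e s).1 = C (-e) * (s.1 - C (1 / (e * quot e s)) * (X * s.2)) := by
  have : (s.1 - C (1 / (e * quot e s)) * (X * s.2)).IsRoot e := by
    simp only [IsRoot, eval_sub, eval_mul, eval_C, eval_X, quot]
    field_simp
    ring
  rw [strip, mul_left_comm, mul_divByMonic_eq_iff_isRoot.2 this]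

theorem strip_snd_mul (hP : s.1.eval e ≠ 0) :
    (X - C e) * (strip e s).2 = C (-e) * (s.2 - C (quot e s) * s.1) := by
  have : (s.2 - C (quot e s) * s.1).IsRoot e := by
    simp only [IsRoot, eval_sub, eval_mul, eval_C, quot]
    field_simp
    ring
  rw [strip, mul_left_comm, mul_divByMonic_eq_iff_isRoot.2 this]

theorem eval_strip_fst (he : e ≠ 0) (hP : s.1.eval e ≠ 0) (hQ : s.2.eval e ≠ 0) (y : ℝ) :
    (e - y) * (strip e s).1.eval y =
      e * (s.1.eval y - 1 / (e * quot e s) * (y * s.2.eval y)) := by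
  have := congrArg (eval y) (strip_fst_mul he hP hQ)
  simp only [eval_sub, eval_mul, eval_C, eval_X] at this
  linarith

theorem eval_strip_snd (hP : s.1.eval e ≠ 0) (y : ℝ) :
    (e - y) * (strip e s).2.eval y = e * (s.2.eval y - quot e s * s.1.eval y) := by
  have := congrArg (eval y) (strip_snd_mul (e := e) hP)
  simp only [eval_sub, eval_mul, eval_C, eval_X] at this
  linarith

theorem eq_of_mul_sub_eq {p q : ℝ[X]} (e : ℝ) (h : ∀ y, (e - y) * p.eval y = (e - y) * q.eval y) :
    p = q :=
  Polynomial.funext <| eq_of_eqOn_compl p.continuous q.continuous (e := e) fun y hy =>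
    mul_left_cancel₀ (sub_ne_zero.2 hy.symm) (h y)

/-- The system defining `(P₁, Q₁)` has determinant `1 - g h y = (e - y) / e`, since `e g h = 1`; its
inversion therefore cancels the factor `e - y`. -/
theorem eq_strip_snd_add (he : e ≠ 0) (hP : s.1.eval e ≠ 0) (hQ : s.2.eval e ≠ 0) :
    s.2 = (strip e s).2 + C (quot e s) * (strip e s).1 := by
  refine eq_of_mul_sub_eq e fun y => ?_
  have h1 := eval_strip_fst he hP hQ y
  have h2 := eval_strip_snd hP y
  have hq : quot e s ≠ 0 := div_ne_zero hQ hP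
  simp only [eval_add, eval_mul, eval_C]
  rw [mul_add, h2, mul_left_comm, h1]
  field_simp
  ring

theorem eq_strip_fst_add (he : e ≠ 0) (hP : s.1.eval e ≠ 0) (hQ : s.2.eval e ≠ 0) :
    s.1 = (strip e s).1 + C (1 / (e * quot e s)) * (X * (strip e s).2) := by
  refine eq_of_mul_sub_eq e fun y => ?_
  have h1 := eval_strip_fst he hP hQ y
  have h2 := eval_strip_snd hP y
  have hq : quot e s ≠ 0 := div_ne_zero hQ hP
  simp only [eval_add, eval_mul, eval_C, eval_X]
  have hg : 1 / (e * quot e s) * (e * quot e s) = 1 := one_div_mul_cancel (mul_ne_zero he hq)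
  linear_combination -h1 - 1 / (e * quot e s) * y * h2 + y * s.1.eval y * hg

/-- A bound uniform in `e` and `s`, with no sign conditions: the interpolation arguments below need
no more than this. -/
theorem natDegree_strip {N : ℕ} (h1 : s.1.natDegree ≤ N) (h2 : s.2.natDegree ≤ N) :
    (strip e s).1.natDegree ≤ N ∧ (strip e s).2.natDegree ≤ N := by
  constructor
  · refine (natDegree_C_mul_le _ _).trans ?_
    rw [natDegree_divByMonic _ (monic_X_sub_C e), natDegree_X_sub_C, Nat.sub_le_iff_le_add]
    refine (natDegree_sub_le _ _).trans (max_le (by omega) ?_)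
    refine (natDegree_C_mul_le _ _).trans (natDegree_mul_le.trans ?_)
    simp only [natDegree_X]
    omega
  · refine (natDegree_C_mul_le _ _).trans ?_
    rw [natDegree_divByMonic _ (monic_X_sub_C e), natDegree_X_sub_C, Nat.sub_le_iff_le_add]
    refine (natDegree_sub_le _ _).trans (max_le (by omega) ?_)
    exact (natDegree_C_mul_le _ _).trans (by omega)

end strip

/-! ### Rational Stieltjes functions -/

/-- The pair `(P, Q)` describes a rational Stieltjes function `Q / P`, holomorphic and positive on
`(-σ, ∞)`, which encodes `l` peakons. -/
structure IsStage (σ : ℝ) (l : ℕ) (s : ℝ[X] × ℝ[X]) : Prop where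
  fst_pos : ∀ y, -σ < y → 0 < s.1.eval y
  snd_pos : 0 < l → ∀ y, -σ < y → 0 < s.2.eval y
  -- The two kernels say that `-Q / P` and `y Q / P` are both Pick functions. The degree conditions
  -- count the remaining peakons; for `l = 0` they force `Q = 0`.
  kernel_fst : ∃ k, IsSqKernel k ∧
    ∀ x y, s.1.eval x * s.2.eval y - s.2.eval x * s.1.eval y = (x - y) * k x y
  kernel_snd : ∃ k, IsSqKernel k ∧
    ∀ x y, x * s.2.eval x * s.1.eval y - y * s.2.eval y * s.1.eval x = (x - y) * k x y
  coprime : IsCoprime s.1 s.2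
  degree_even : ∀ r : ℕ, l = 2 * r → s.1.degree = r ∧ s.2.degree < r
  degree_odd : ∀ r : ℕ, l = 2 * r + 1 → s.2.degree = r ∧ s.1.degree ≤ r

theorem cancel_kernel {f g : ℝ → ℝ → ℝ} {e : ℝ} (hf1 : ∀ y, Continuous fun x => f x y)
    (hf2 : ∀ x, Continuous (f x)) (hg1 : ∀ y, Continuous fun x => g x y)
    (hg2 : ∀ x, Continuous (g x))
    (h : ∀ x y, (x - e) * (y - e) * f x y = (x - e) * (y - e) * g x y) (x y : ℝ) :
    f x y = g x y := by
  refine eq_of_eqOn_compl (hf1 y) (hg1 y) (e := e) (fun x hx => ?_) x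
  refine eq_of_eqOn_compl (hf2 x) (hg2 x) (e := e) (fun y hy => ?_) y
  exact mul_left_cancel₀ (mul_ne_zero (sub_ne_zero.2 hx) (sub_ne_zero.2 hy)) (h x y)

theorem withBot_eq_of_one_add_eq {d : WithBot ℕ} {r : ℕ}
    (h : 1 + d = ((r + 1 : ℕ) : WithBot ℕ)) : d = r := by
  cases d with
  | bot =>
    rw [WithBot.add_bot] at h
    exact absurd h.symm WithBot.coe_ne_bot
  | coe d => rw [← Nat.cast_withBot] at h ⊢; norm_cast at h ⊢; omega

theorem withBot_lt_of_one_add_le {d : WithBot ℕ} {r : ℕ} (h : 1 + d ≤ (r : WithBot ℕ)) :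
    d < r := by
  cases d with
  | bot => exact WithBot.bot_lt_coe _
  | coe d => rw [← Nat.cast_withBot] at h ⊢; norm_cast at h ⊢; omega

theorem withBot_le_of_one_add_le {d : WithBot ℕ} {r : ℕ}
    (h : 1 + d ≤ ((r + 1 : ℕ) : WithBot ℕ)) : d ≤ r := by
  cases d with
  | bot => exact bot_le
  | coe d => rw [← Nat.cast_withBot] at h ⊢; norm_cast at h ⊢; omega

theorem withBot_one_add_le_of_lt {d : WithBot ℕ} {r : ℕ}
    (h : d < ((r + 1 : ℕ) : WithBot ℕ)) : 1 + d ≤ ((r + 1 : ℕ) : WithBot ℕ) := by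
  cases d with
  | bot => simp
  | coe d => rw [← Nat.cast_withBot] at h ⊢; norm_cast at h ⊢; omega

/-- The derivative of a quotient in terms of the kernel of its numerator and denominator. -/
theorem hasDerivAt_div_of_kernel {p q : ℝ[X]} {k : ℝ → ℝ → ℝ} (hk : IsSqKernel k)
    (h : ∀ x y, q.eval x * p.eval y - q.eval y * p.eval x = (x - y) * k x y) {x : ℝ}
    (hp : p.eval x ≠ 0) :
    HasDerivAt (fun y => q.eval y / p.eval y) (k x x / p.eval x ^ 2) x := by
  have h1 : HasDerivAt (fun y => q.eval x * p.eval y - q.eval y * p.eval x)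
      (q.eval x * p.derivative.eval x - q.derivative.eval x * p.eval x) x :=
    ((p.hasDerivAt x).const_mul _).sub ((q.hasDerivAt x).mul_const _)
  have h2 : HasDerivAt (fun y => (x - y) * k x y) (-1 * k x x + (x - x) * deriv (k x) x) x :=
    ((hasDerivAt_id x).const_sub x).mul (hk.differentiable x x).hasDerivAt
  have h3 := h1.unique (by simpa only [h] using h2)
  refine ((q.hasDerivAt x).fun_div (p.hasDerivAt x) hp).congr_deriv ?_
  congr 1
  linear_combination -h3

theorem strictMonoOn_div_of_kernel {p q : ℝ[X]} {k : ℝ → ℝ → ℝ} (hk : IsSqKernel k)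
    (h : ∀ x y, q.eval x * p.eval y - q.eval y * p.eval x = (x - y) * k x y) {a : ℝ}
    (hp : ∀ x, a < x → 0 < p.eval x) (hpos : ∀ x, a < x → k x x ≠ 0) :
    StrictMonoOn (fun y => q.eval y / p.eval y) (Set.Ioi a) := by
  refine strictMonoOn_of_deriv_pos (convex_Ioi a) ?_ fun x hx => ?_
  · exact q.continuous.continuousOn.div p.continuous.continuousOn fun x hx => (hp x hx).ne'
  · rw [interior_Ioi] at hx
    rw [(hasDerivAt_div_of_kernel hk h (hp x hx).ne').deriv]
    have := (hk.self_nonneg x).lt_of_ne' (hpos x hx)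
    have := hp x hx
    positivity

namespace IsStage

variable {σ : ℝ} {l : ℕ} {s : ℝ[X] × ℝ[X]} {e : ℝ}

theorem quot_pos (h : IsStage σ (l + 1) s) {y : ℝ} (hy : -σ < y) : 0 < quot y s :=
  div_pos (h.snd_pos l.succ_pos y hy) (h.fst_pos y hy)

/-- `y Q / P` is strictly increasing. -/
theorem strictMonoOn (h : IsStage σ (l + 1) s) (hσ : 0 < σ) :
    StrictMonoOn (fun y => y * quot y s) (Set.Ioi 0) := by
  obtain ⟨k, hk, hks⟩ := h.kernel_snd
  have := strictMonoOn_div_of_kernel (p := s.1) (q := X * s.2) (a := 0) hk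
    (fun x y => by simpa using hks x y) (fun x hx => h.fst_pos x (by linarith)) fun x hx h0 => by
      -- If the kernel degenerated at `x`, the choice `y = 0` would give `x Q(x) P(0) = 0`.
      have h1 := hks x 0
      rw [hk.eq_zero_of_self_eq_zero h0] at h1
      have h2 := h.snd_pos l.succ_pos x (by linarith)
      have h3 := h.fst_pos 0 (by linarith)
      have : 0 < x * s.2.eval x * s.1.eval 0 := by positivity
      linarith
  refine this.congr fun y _ => ?_
  simp [quot, mul_div_assoc]

/-- `Q / P` is not constant if it encodes at least two peakons. -/
theorem ne_const_mul (h : IsStage σ (l + 2) s) {a : ℝ} (ha : a ≠ 0) : s.2 ≠ C a * s.1 := by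
  intro heq
  have hd : s.2.degree = s.1.degree := by rw [heq, degree_C_mul ha]
  rcases Nat.even_or_odd' l with ⟨r, rfl | rfl⟩
  · obtain ⟨h1, h2⟩ := h.degree_even (r + 1) (by ring)
    exact absurd h2 (by rw [hd, h1]; exact lt_irrefl _)
  · obtain ⟨h1, -⟩ := h.degree_odd (r + 1) (by ring)
    -- For proportional `P` and `Q` of equal degree, coprimality makes `P` a constant, contradicting
    -- the degree `r + 1`.
    have hu : IsUnit s.1 := by
      have := h.coprime
      rw [heq] at this
      exact isCoprime_self.1 ((isCoprime_mul_unit_left_right (isUnit_C.2 ha.isUnit) _ _).1 this)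
    rw [hd, degree_eq_zero_of_isUnit hu] at h1
    norm_cast at h1

/-- A kernel degenerate at one point would make `Q` a multiple of `P`. At least two peakons are
required: for a single one `Q / P` is constant. -/
theorem strictAntiOn (h : IsStage σ (l + 2) s) :
    StrictAntiOn (fun y => quot y s) (Set.Ioi (-σ)) := by
  obtain ⟨k, hk, hks⟩ := h.kernel_fst
  have := strictMonoOn_div_of_kernel (p := s.1) (q := -s.2) (a := -σ) hk
    (fun x y => by rw [← hks]; simp; ring) (fun x hx => h.fst_pos x hx) fun x hx h0 => by
      have h2 := h.snd_pos (by omega) x hx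
      have h3 := h.fst_pos x hx
      refine h.ne_const_mul (div_pos h2 h3).ne' (Polynomial.funext fun y => ?_)
      have h1 := hks x y
      rw [hk.eq_zero_of_self_eq_zero h0] at h1
      simp only [eval_mul, eval_C]
      field_simp
      linarith
  intro x hx y hy hxy
  have := this hx hy hxy
  simp only [eval_neg, neg_div] at this
  simpa [quot] using this

/-- With `F = Q / P`, the number `h P₁(y) / P(y)` is the difference quotient of the increasing
function `y F` between `e` and `y`; at `y = e` it is replaced by a diagonal value of the kernel. -/
theorem strip_fst_pos (h : IsStage σ (l + 1) s) (he : 0 < e) (hσ : 0 < σ) {y : ℝ}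
    (hy : -σ < y) : 0 < (strip e s).1.eval y := by
  have hPe := h.fst_pos e (by linarith)
  have hQe := h.snd_pos l.succ_pos e (by linarith)
  have hPy := h.fst_pos y hy
  have hQy := h.snd_pos l.succ_pos y hy
  have hq := h.quot_pos (y := e) (by linarith)
  have hev := eval_strip_fst he.ne' hPe.ne' hQe.ne' y
  rcases eq_or_ne y e with rfl | hne
  · obtain ⟨k, hk, hks⟩ := h.kernel_snd
    have hk1 : ∀ x, (strip y s).1.eval x = k y x / s.2.eval y := by
      refine eq_of_eqOn_compl (strip y s).1.continuous
        ((hk.differentiable y).continuous.div_const _) (e := y) fun x hx => ?_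
      have h1 := eval_strip_fst he.ne' hPe.ne' hQe.ne' x
      have h2 := hks y x
      refine mul_left_cancel₀ (sub_ne_zero.2 hx.symm) (h1.trans ?_)
      rw [mul_div_assoc', ← h2, quot]
      field_simp
    rw [hk1]
    refine div_pos ((hk.self_nonneg y).lt_of_ne' fun h0 => ?_) hQe
    have h1 := hks y 0
    rw [hk.eq_zero_of_self_eq_zero h0] at h1
    have h3 := h.fst_pos 0 (by linarith)
    have : 0 < y * s.2.eval y * s.1.eval 0 := by positivity
    linarith
  · have hmul : (e - y) * ((strip e s).1.eval y * (quot e s)) =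
        s.1.eval y * (e * quot e s - y * quot y s) := by
      rw [← mul_assoc, hev, quot, quot]
      field_simp
    have hcross : 0 < (e - y) * (e * quot e s - y * quot y s) := by
      -- Monotonicity of `y F` is available for `y > 0` only; for `y ≤ 0` the signs suffice.
      rcases le_or_gt y 0 with hy0 | hy0
      · have h1 : 0 < e * quot e s := by positivity
        have h2 : y * quot y s ≤ 0 := mul_nonpos_of_nonpos_of_nonneg hy0 (h.quot_pos hy).le
        exact mul_pos (by linarith) (by linarith)
      · rcases hne.lt_or_gt with hlt | hlt
        · have := h.strictMonoOn hσ (Set.mem_Ioi.2 hy0) (Set.mem_Ioi.2 he) hlt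
          exact mul_pos (by linarith) (by simpa using this)
        · have := h.strictMonoOn hσ (Set.mem_Ioi.2 he) (Set.mem_Ioi.2 hy0) hlt
          exact mul_pos_of_neg_of_neg (by linarith) (by simpa using this)
    have hsq : 0 < (e - y) ^ 2 := by
      have := sub_ne_zero.2 hne.symm
      positivity
    have : 0 < (e - y) ^ 2 * quot e s * (strip e s).1.eval y := by
      have h5 : (e - y) ^ 2 * quot e s * (strip e s).1.eval y =
        s.1.eval y * ((e - y) * (e * quot e s - y * quot y s)) := by
        linear_combination (e - y) * hmul
      rw [h5]
      exact mul_pos hPy hcross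
    exact (pos_iff_pos_of_mul_pos this).1 (by positivity)

/-- Here `Q₁(y) / (e P(y))` is minus the difference quotient of the decreasing function `Q / P`. -/
theorem strip_snd_pos (h : IsStage σ (l + 2) s) (he : 0 < e) (hσ : 0 < σ) {y : ℝ}
    (hy : -σ < y) : 0 < (strip e s).2.eval y := by
  have hPe := h.fst_pos e (by linarith)
  have hQe := h.snd_pos (by omega) e (by linarith)
  have hPy := h.fst_pos y hy
  rcases eq_or_ne y e with rfl | hne
  · obtain ⟨k, hk, hks⟩ := h.kernel_fst
    have hk1 : ∀ x, (strip y s).2.eval x = y * k y x / s.1.eval y := by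
      refine eq_of_eqOn_compl (strip y s).2.continuous
        (((hk.differentiable y).continuous.const_mul _).div_const _) (e := y) fun x hx => ?_
      have h1 := eval_strip_snd hPe.ne' x
      have h2 := hks y x
      refine mul_left_cancel₀ (sub_ne_zero.2 hx.symm) (h1.trans ?_)
      rw [mul_div_assoc', mul_left_comm, ← h2, quot]
      field_simp
    rw [hk1]
    refine div_pos (mul_pos he ((hk.self_nonneg y).lt_of_ne' fun h0 => ?_)) hPe
    refine h.ne_const_mul (div_pos hQe hPe).ne' (Polynomial.funext fun x => ?_)
    have h1 := hks y x
    rw [hk.eq_zero_of_self_eq_zero h0] at h1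
    simp only [eval_mul, eval_C]
    field_simp
    linarith
  · have hev := eval_strip_snd (e := e) hPe.ne' y
    have hcross : 0 < (e - y) * (quot y s - quot e s) := by
      rcases hne.lt_or_gt with hlt | hlt
      · have := h.strictAntiOn (Set.mem_Ioi.2 hy) (Set.mem_Ioi.2 (by linarith)) hlt
        exact mul_pos (by linarith) (by simpa using this)
      · have := h.strictAntiOn (Set.mem_Ioi.2 (by linarith)) (Set.mem_Ioi.2 hy) hlt
        exact mul_pos_of_neg_of_neg (by linarith) (by simpa using this)
    have hsq : 0 < (e - y) ^ 2 := by
      have := sub_ne_zero.2 hne.symm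
      positivity
    have : 0 < (e - y) ^ 2 * (strip e s).2.eval y := by
      have h5 : (e - y) ^ 2 * (strip e s).2.eval y =
        e * s.1.eval y * ((e - y) * (quot y s - quot e s)) := by
        have : quot y s * s.1.eval y = s.2.eval y := div_mul_cancel₀ _ hPy.ne'
        linear_combination (e - y) * hev - e * (e - y) * this
      rw [h5]
      exact mul_pos (mul_pos he hPy) hcross
    exact (pos_iff_pos_of_mul_pos this).1 hsq

/-- The combination `G = e k₁ + k₂` satisfies `G(x, e) = Q(x) P(e)`. Expanding the new expression
and using `e g h = 1` leaves `e` times the Schur complement of `G` at `e`, divided by `(x - e)(y -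
e)`. -/
theorem strip_kernel_fst (h : IsStage σ (l + 1) s) (he : 0 < e) (hσ : 0 < σ) :
    ∃ k, IsSqKernel k ∧ ∀ x y, (strip e s).1.eval x * (strip e s).2.eval y -
      (strip e s).2.eval x * (strip e s).1.eval y = (x - y) * k x y := by
  have hPe := h.fst_pos e (by linarith)
  have hQe := h.snd_pos l.succ_pos e (by linarith)
  have hq := h.quot_pos (y := e) (by linarith)
  obtain ⟨k₁, hk₁, hs₁⟩ := h.kernel_fst
  obtain ⟨k₂, hk₂, hs₂⟩ := h.kernel_snd
  have hG := (hk₁.const_mul he.le).add hk₂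
  have hGe : ∀ x, e * k₁ x e + k₂ x e = s.2.eval x * s.1.eval e := by
    refine eq_of_eqOn_compl (hG.continuous_left e) (by fun_prop) (e := e) fun x hx => ?_
    refine mul_left_cancel₀ (sub_ne_zero.2 hx) ?_
    linear_combination -e * hs₁ x e - hs₂ x e
  obtain ⟨k, hk, hs⟩ := hG.schur (e := e) (by simp only [hGe]; positivity)
  simp only [hGe] at hs
  have hk' := hk.const_mul he.le
  refine ⟨_, hk', cancel_kernel (e := e) (by intro; fun_prop) (by intro; fun_prop)
    (fun y => (continuous_id.sub continuous_const).mul (hk'.continuous_left y))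
    (fun x => (continuous_const.sub continuous_id).mul (hk'.differentiable x).continuous)
    fun x y => ?_⟩
  have h1 := eval_strip_fst he.ne' hPe.ne' hQe.ne'
  have h2 := eval_strip_snd (e := e) hPe.ne'
  have h3 : (x - e) * (y - e) * ((strip e s).1.eval x * (strip e s).2.eval y -
      (strip e s).2.eval x * (strip e s).1.eval y) =
      ((e - x) * (strip e s).1.eval x) * ((e - y) * (strip e s).2.eval y) -
      ((e - x) * (strip e s).2.eval x) * ((e - y) * (strip e s).1.eval y) := by ring
  rw [h3, h1, h1, h2, h2,
    show (x - e) * (y - e) * ((x - y) * (e * k x y)) =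
      e * (x - y) * ((x - e) * (y - e) * k x y) by ring, hs]
  have hg : 1 / (e * quot e s) * (e * quot e s) = 1 := one_div_mul_cancel (by positivity)
  have hgg : s.1.eval e / s.2.eval e = 1 / (e * quot e s) * e := by
    rw [quot]; field_simp
  have hdiv : s.2.eval x * s.1.eval e * (s.2.eval y * s.1.eval e) / (s.2.eval e * s.1.eval e) =
      s.2.eval x * s.2.eval y * (s.1.eval e / s.2.eval e) := by
    field_simp
  rw [hdiv, hgg]
  generalize 1 / (e * quot e s) = g at *
  linear_combination e ^ 2 * hs₁ x y + e * (g * (e * quot e s)) * hs₂ x y +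
    e * (x - y) * k₂ x y * hg

/-- The same mechanism with `G = x y k₁ + e k₂`, for which `G(x, e) = e Q(e) P(x)`. -/
theorem strip_kernel_snd (h : IsStage σ (l + 1) s) (he : 0 < e) (hσ : 0 < σ) :
    ∃ k, IsSqKernel k ∧ ∀ x y, x * (strip e s).2.eval x * (strip e s).1.eval y -
      y * (strip e s).2.eval y * (strip e s).1.eval x = (x - y) * k x y := by
  have hPe := h.fst_pos e (by linarith)
  have hQe := h.snd_pos l.succ_pos e (by linarith)
  have hq := h.quot_pos (y := e) (by linarith)
  obtain ⟨k₁, hk₁, hs₁⟩ := h.kernel_fst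
  obtain ⟨k₂, hk₂, hs₂⟩ := h.kernel_snd
  have hG := (hk₁.sq_mul X).add (hk₂.const_mul he.le)
  simp only [eval_X] at hG
  have hGe : ∀ x, x * e * k₁ x e + e * k₂ x e = e * s.2.eval e * s.1.eval x := by
    refine eq_of_eqOn_compl (hG.continuous_left e) (by fun_prop) (e := e) fun x hx => ?_
    refine mul_left_cancel₀ (sub_ne_zero.2 hx) ?_
    linear_combination -x * e * hs₁ x e - e * hs₂ x e
  obtain ⟨k, hk, hs⟩ := hG.schur (e := e) (by simp only [hGe]; positivity)
  simp only [hGe] at hs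
  have hk' := hk.const_mul he.le
  refine ⟨_, hk', cancel_kernel (e := e) (by intro; fun_prop) (by intro; fun_prop)
    (fun y => (continuous_id.sub continuous_const).mul (hk'.continuous_left y))
    (fun x => (continuous_const.sub continuous_id).mul (hk'.differentiable x).continuous)
    fun x y => ?_⟩
  have h1 := eval_strip_fst he.ne' hPe.ne' hQe.ne'
  have h2 := eval_strip_snd (e := e) hPe.ne'
  have h3 : (x - e) * (y - e) * (x * (strip e s).2.eval x * (strip e s).1.eval y -
      y * (strip e s).2.eval y * (strip e s).1.eval x) =
      x * ((e - x) * (strip e s).2.eval x) * ((e - y) * (strip e s).1.eval y) -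
      y * ((e - y) * (strip e s).2.eval y) * ((e - x) * (strip e s).1.eval x) := by ring
  rw [h3, h1, h1, h2, h2,
    show (x - e) * (y - e) * ((x - y) * (e * k x y)) =
      e * (x - y) * ((x - e) * (y - e) * k x y) by ring, hs]
  have hg : 1 / (e * quot e s) * (e * quot e s) = 1 := one_div_mul_cancel (by positivity)
  have hdiv : e * s.2.eval e * s.1.eval x * (e * s.2.eval e * s.1.eval y) /
      (e * s.2.eval e * s.1.eval e) = e * s.1.eval x * s.1.eval y * quot e s := by
    rw [quot]
    field_simp
  rw [hdiv]
  generalize 1 / (e * quot e s) = g at *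
  linear_combination e ^ 2 * hs₂ x y + e * (g * (e * quot e s)) * x * y * hs₁ x y +
    e * (x - y) * x * y * k₁ x y * hg

/-- Removing a peakon leads from Stieltjes functions to Stieltjes functions. -/
theorem strip (h : IsStage σ (l + 1) s) (he : 0 < e) (hσ : 0 < σ) :
    IsStage σ l (strip e s) := by
  have hPe := h.fst_pos e (by linarith)
  have hQe := h.snd_pos l.succ_pos e (by linarith)
  have hq := h.quot_pos (y := e) (by linarith)
  have hd1 := congrArg degree (strip_fst_mul he.ne' hPe.ne' hQe.ne')
  have hd2 := congrArg degree (strip_snd_mul (e := e) hPe.ne')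
  rw [degree_mul, degree_X_sub_C, degree_C_mul (neg_ne_zero.2 he.ne')] at hd1 hd2
  have hg0 : 1 / (e * quot e s) ≠ 0 := by positivity
  refine ⟨fun y hy => h.strip_fst_pos he hσ hy, fun hl y hy => ?_, h.strip_kernel_fst he hσ,
    h.strip_kernel_snd he hσ, ?_, ?_, ?_⟩
  · obtain ⟨l, rfl⟩ := Nat.exists_eq_succ_of_ne_zero hl.ne'
    exact h.strip_snd_pos he hσ hy
  · obtain ⟨a, b, hab⟩ := h.coprime
    have e1 := eq_strip_fst_add he.ne' hPe.ne' hQe.ne'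
    have e2 := eq_strip_snd_add he.ne' hPe.ne' hQe.ne'
    refine ⟨a + b * C (quot e s), a * C (1 / (e * quot e s)) * X + b, ?_⟩
    linear_combination hab - a * e1 - b * e2
  · rintro r rfl
    obtain ⟨h1, h2⟩ := h.degree_odd r rfl
    have hdX : (C (1 / (e * quot e s)) * (X * s.2)).degree = ((r + 1 : ℕ) : WithBot ℕ) := by
      rw [degree_C_mul hg0, degree_mul, degree_X, h1, add_comm]; rfl
    -- With an odd number of peakons `y Q` dominates `P`; with an even number `h P` dominates `Q`.
    -- The leading terms thus determine one of the two new degrees exactly, and the other is only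
    -- bounded.
    have hlt : s.1.degree < (C (1 / (e * quot e s)) * (X * s.2)).degree := by
      rw [hdX]; exact h2.trans_lt (by exact_mod_cast Nat.lt_succ_self r)
    rw [degree_sub_eq_right_of_degree_lt hlt, hdX] at hd1
    have hle : (s.2 - C (quot e s) * s.1).degree ≤ r :=
      (degree_sub_le _ _).trans (max_le h1.le (by rwa [degree_C_mul hq.ne']))
    rw [← hd2] at hle
    constructor
    · exact withBot_eq_of_one_add_eq hd1
    · exact withBot_lt_of_one_add_le hle
  · rintro r rfl
    obtain ⟨h1, h2⟩ := h.degree_even (r + 1) (by ring)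
    have hlt : s.2.degree < (C (quot e s) * s.1).degree := by
      rwa [degree_C_mul hq.ne', h1]
    rw [degree_sub_eq_right_of_degree_lt hlt, degree_C_mul hq.ne', h1] at hd2
    have hle : (s.1 - C (1 / (e * quot e s)) * (X * s.2)).degree ≤ ((r + 1 : ℕ) : WithBot ℕ) := by
      refine (degree_sub_le _ _).trans (max_le h1.le ?_)
      rw [degree_C_mul hg0, degree_mul, degree_X]
      exact withBot_one_add_le_of_lt h2
    rw [← hd1] at hle
    constructor
    · exact withBot_eq_of_one_add_eq hd2
    · exact withBot_le_of_one_add_le hle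

/-- Two consecutive values of `h` are controlled by a lower bound of the spectrum. -/
theorem quot_strip_lt (h : IsStage σ (l + 2) s) (he : 0 < e) {τ : ℝ} (hτ : 0 < τ) (hτσ : τ < σ)
    {y : ℝ} (hy : 0 < y) : quot y (MCH.strip e s) < e * quot e s / τ := by
  have hσ : 0 < σ := hτ.trans hτσ
  have h' := h.strip he hσ
  have hPe := h.fst_pos e (by linarith)
  have hQe := h.snd_pos (by omega) e (by linarith)
  have hq := h.quot_pos (y := e) (by linarith)
  -- The shorter function is decreasing (constant for one remaining peakon), so it is largest at the
  -- negative point `-τ`, where both polynomials are still positive.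
  have hle : quot y (MCH.strip e s) ≤ quot (-τ) (MCH.strip e s) := by
    rcases l with _ | l
    · obtain ⟨h1, h2⟩ := h'.degree_odd 0 rfl
      rw [quot, quot, eq_C_of_degree_le_zero h2, eq_C_of_degree_le_zero h1.le]
      simp
    · exact (h'.strictAntiOn (Set.mem_Ioi.2 (by linarith)) (Set.mem_Ioi.2 (by linarith))
        (by linarith)).le
  refine hle.trans_lt ?_
  have h1 := eval_strip_fst he.ne' hPe.ne' hQe.ne' (-τ)
  have h2 := eval_strip_snd hPe.ne' (-τ)
  have hP := h.fst_pos (-τ) (by linarith)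
  have hQ := h.snd_pos (by omega) (-τ) (by linarith)
  have hP' := h'.fst_pos (-τ) (by linarith)
  rw [quot, div_lt_div_iff₀ hP' hτ]
  have hg : 1 / (e * quot e s) * (e * quot e s) = 1 := one_div_mul_cancel (by positivity)
  refine lt_of_mul_lt_mul_left ?_ (show 0 ≤ e - -τ by linarith)
  -- After these substitutions the claim is `τ (Q - h P) < e h P + τ Q` at `-τ`, clear from
  -- positivity of `h P`.
  have h3 : (e - -τ) * ((MCH.strip e s).2.eval (-τ) * τ) =
      e * (s.2.eval (-τ) - quot e s * s.1.eval (-τ)) * τ := by rw [← h2]; ring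
  have h4 : (e - -τ) * (e * quot e s * (MCH.strip e s).1.eval (-τ)) =
      e * (e * quot e s * s.1.eval (-τ) + τ * s.2.eval (-τ)) := by
    linear_combination e * quot e s * h1 + e * τ * s.2.eval (-τ) * hg
  rw [h3, h4]
  have : 0 < e * quot e s * s.1.eval (-τ) := by positivity
  have : 0 < quot e s * s.1.eval (-τ) := by positivity
  nlinarith

end IsStage
end MCH

/-! ### Determinantal formulas for the removal procedure. -/

namespace MCH

open Filter Topology Polynomial

/-! ### Determinants with interlaced columns -/

/-- The Cauchy–Stieltjes–Vandermonde matrix with rows `f, 1, a f, a, a² f, a², …`. -/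
noncomputable def csvA (k : ℕ) (a f : ℕ → ℝ) : Matrix (Fin k) (Fin k) ℝ :=
  Matrix.of fun i j => a i ^ ((j : ℕ) / 2) * if Even (j : ℕ) then f i else 1

/-- The Cauchy–Stieltjes–Vandermonde matrix with rows `1, a f, a, a² f, a², …`. -/
noncomputable def csvB (k : ℕ) (a f : ℕ → ℝ) : Matrix (Fin k) (Fin k) ℝ :=
  Matrix.of fun i j => a i ^ ((j : ℕ) / 2) * if Even (j : ℕ) then 1 else a i * f i

/-- A column permutation changes the determinant only by a sign. Interlacing the columns lets the
reduction treat both parities of `k` at once. -/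
theorem abs_det_csv_of_columns {e : ℕ → ℝ} {F : ℝ → ℝ} {k l p : ℕ} {M : Matrix (Fin k) (Fin k) ℝ}
    (σ : Fin k → Fin k) (hσ : Function.Injective σ) (hM : ∀ i j, M i j = csv e F k l p i (σ j)) :
    |(csv e F k l p).det| = |M.det| := by
  have h := Matrix.abs_det_submatrix_equiv_equiv (Equiv.refl _)
    (Equiv.ofBijective σ (Finite.injective_iff_bijective.1 hσ)) (csv e F k l p)
  rw [← h]
  congr 2
  ext i j
  simp [hM]

theorem abs_det_csv_eq_csvA (e : ℕ → ℝ) (F : ℝ → ℝ) (k : ℕ) :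
    |(csv e F k ((k + 1) / 2) 0).det| =
      |(csvA k (fun i => e (i + 1)) fun i => F (e (i + 1))).det| := by
  refine abs_det_csv_of_columns
    (fun j => ⟨if Even (j : ℕ) then j / 2 else (k + 1) / 2 + j / 2, ?_⟩) ?_ ?_
  · have := j.2
    split_ifs with h
    · omega
    · rw [Nat.not_even_iff] at h; omega
  · intro i j hij
    have := i.2
    have := j.2
    simp only [Fin.mk.injEq, Nat.even_iff] at hij
    ext
    split_ifs at hij <;> omega
  · intro i j
    have hj := j.2
    by_cases h : Even (j : ℕ)
    · have h1 : (j : ℕ) / 2 < (k + 1) / 2 := by rw [Nat.even_iff] at h; omega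
      simp [csvA, csv, h, h1]
    · simp [csvA, csv, h]

theorem abs_det_csv_eq_csvB (e : ℕ → ℝ) (F : ℝ → ℝ) (k : ℕ) :
    |(csv e F k (k / 2) 1).det| =
      |(csvB k (fun i => e (i + 1)) fun i => F (e (i + 1))).det| := by
  refine abs_det_csv_of_columns
    (fun j => ⟨if Even (j : ℕ) then k / 2 + j / 2 else j / 2, ?_⟩) ?_ ?_
  · have := j.2
    split_ifs with h
    · rw [Nat.even_iff] at h; omega
    · omega
  · intro i j hij
    have := i.2
    have := j.2
    simp only [Fin.mk.injEq, Nat.even_iff] at hij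
    ext
    split_ifs at hij <;> omega
  · intro i j
    have hj := j.2
    by_cases h : Even (j : ℕ)
    · simp [csvB, csv, h]
    · have h1 : (j : ℕ) / 2 < k / 2 := by rw [Nat.not_even_iff] at h; omega
      simp [csvB, csv, h, h1]
      ring

/-- The determinant of a matrix whose columns can be reduced to a bordered smaller matrix. -/
theorem det_succ_of_columns {k : ℕ} {M : Matrix (Fin (k + 1)) (Fin (k + 1)) ℝ}
    {M' : Matrix (Fin k) (Fin k) ℝ} (c κ d : Fin k → ℝ)
    (h0 : ∀ j, M 0 j.succ = c j * M 0 j.castSucc)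
    (hs : ∀ i j, M i.succ j.succ = d i * (κ j * M' i j) + c j * M i.succ j.castSucc) :
    M.det = M 0 0 * (∏ i, d i) * (∏ j, κ j) * M'.det := by
  -- Subtracting `c j` times the preceding column clears the first row except for its corner.
  rw [Matrix.det_eq_of_forall_col_eq_smul_add_pred
    (B := Matrix.of fun i => Fin.cons (M i 0) fun j => M i j.succ - c j * M i j.castSucc) c
    (fun i => by simp) (fun i j => by simp), Matrix.det_succ_row_zero, Fin.sum_univ_succ]
  simp only [Matrix.of_apply, Fin.cons_succ, h0, sub_self, Fin.cons_zero]
  simp only [mul_zero, zero_mul, Finset.sum_const_zero, add_zero, Fin.val_zero, pow_zero, one_mul,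
    Fin.succAbove_zero]
  have : (Matrix.submatrix (Matrix.of fun i : Fin (k + 1) =>
      (Fin.cons (M i 0) fun j => M i j.succ - c j * M i j.castSucc : Fin (k + 1) → ℝ))
      Fin.succ Fin.succ) = Matrix.of fun i j => d i * (Matrix.of fun i j => κ j * M' i j) i j := by
    ext i j
    simp [hs]
  rw [this, Matrix.det_mul_column, Matrix.det_mul_row]
  ring

/-- The transformed values `e h (F - h) / (e h - y F)`. -/
noncomputable def reduce (a f : ℕ → ℝ) (i : ℕ) : ℝ :=
  a 0 * f 0 * (f (i + 1) - f 0) / (a 0 * f 0 - a (i + 1) * f (i + 1))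

/-- The column factors that appear in the reduction of `csvA`. -/
noncomputable def colA (q : ℝ) (j : ℕ) : ℝ := if Even j then -q else -1

/-- The column factors that appear in the reduction of `csvB`. -/
noncomputable def colB (q : ℝ) (j : ℕ) : ℝ := if Even j then -1 else -q

section

variable {k : ℕ} {a f : ℕ → ℝ}

/-- In the first row, consecutive entries have ratio `1 / h` or `e h` alternately. After the column
subtraction every other row is `e h - y F` times a row built from the reduced values, up to column
factors. -/
theorem det_csvA_succ (ha : a 0 ≠ 0) (hf : f 0 ≠ 0)
    (hd : ∀ i < k, a 0 * f 0 - a (i + 1) * f (i + 1) ≠ 0) :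
    (csvA (k + 1) a f).det = f 0 * (∏ i : Fin k, (a 0 * f 0 - a (i + 1) * f (i + 1))) *
      (∏ j : Fin k, colA (1 / (a 0 * f 0 ^ 2)) j) *
      (csvA k (fun i => a (i + 1)) (reduce a f)).det := by
  rw [det_succ_of_columns (M' := csvA k (fun i => a (i + 1)) (reduce a f))
    (fun j : Fin k => if Even (j : ℕ) then 1 / f 0 else a 0 * f 0)
    (fun j => colA (1 / (a 0 * f 0 ^ 2)) j) fun i => a 0 * f 0 - a (i + 1) * f (i + 1)]
  · simp [csvA]
  · intro j
    by_cases h : Even (j : ℕ)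
    · have h2 : ((j : ℕ) + 1) / 2 = j / 2 := by rw [Nat.even_iff] at h; omega
      simp [csvA, h, Nat.even_add_one, h2]
      field_simp
    · have h2 : ((j : ℕ) + 1) / 2 = j / 2 + 1 := by rw [Nat.not_even_iff] at h; omega
      simp [csvA, h, Nat.even_add_one, h2]
      ring
  · intro i j
    have hdi := hd i i.2
    by_cases h : Even (j : ℕ)
    · have h2 : ((j : ℕ) + 1) / 2 = j / 2 := by rw [Nat.even_iff] at h; omega
      simp [csvA, h, Nat.even_add_one, h2, colA, reduce]
      field_simp
      ring
    · have h2 : ((j : ℕ) + 1) / 2 = j / 2 + 1 := by rw [Nat.not_even_iff] at h; omega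
      simp [csvA, h, Nat.even_add_one, h2, colA]
      ring

theorem det_csvB_succ (ha : a 0 ≠ 0) (hf : f 0 ≠ 0)
    (hd : ∀ i < k, a 0 * f 0 - a (i + 1) * f (i + 1) ≠ 0) :
    (csvB (k + 1) a f).det = (∏ i : Fin k, (a 0 * f 0 - a (i + 1) * f (i + 1))) *
      (∏ j : Fin k, colB (1 / (a 0 * f 0 ^ 2)) j) *
      (csvB k (fun i => a (i + 1)) (reduce a f)).det := by
  rw [det_succ_of_columns (M' := csvB k (fun i => a (i + 1)) (reduce a f))
    (fun j : Fin k => if Even (j : ℕ) then a 0 * f 0 else 1 / f 0)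
    (fun j => colB (1 / (a 0 * f 0 ^ 2)) j) fun i => a 0 * f 0 - a (i + 1) * f (i + 1)]
  · simp [csvB]
  · intro j
    by_cases h : Even (j : ℕ)
    · have h2 : ((j : ℕ) + 1) / 2 = j / 2 := by rw [Nat.even_iff] at h; omega
      simp [csvB, h, Nat.even_add_one, h2]
      ring
    · have h2 : ((j : ℕ) + 1) / 2 = j / 2 + 1 := by rw [Nat.not_even_iff] at h; omega
      simp [csvB, h, Nat.even_add_one, h2]
      field_simp
      ring
  · intro i j
    have hdi := hd i i.2
    by_cases h : Even (j : ℕ)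
    · have h2 : ((j : ℕ) + 1) / 2 = j / 2 := by rw [Nat.even_iff] at h; omega
      simp [csvB, h, Nat.even_add_one, h2, colB]
      ring
    · have h2 : ((j : ℕ) + 1) / 2 = j / 2 + 1 := by rw [Nat.not_even_iff] at h; omega
      simp [csvB, h, Nat.even_add_one, h2, colB, reduce]
      field_simp
      ring

/-- The ratio of the products of column factors in two consecutive reductions. -/
theorem prod_col_mul_prod_col (q : ℝ) (k : ℕ) :
    ((∏ j ∈ Finset.range (k + 1), colA q j) * ∏ j ∈ Finset.range k, colA q j) =
      q * ((∏ j ∈ Finset.range (k + 1), colB q j) * ∏ j ∈ Finset.range k, colB q j) := by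
  induction k with
  | zero => simp [colA, colB]
  | succ k ih =>
    have h : colA q (k + 1) * colA q k = colB q (k + 1) * colB q k := by
      by_cases h : Even k <;> simp [colA, colB, h, Nat.even_add_one]
    rw [Finset.prod_range_succ _ (k + 1), Finset.prod_range_succ _ (k + 1)]
    nth_rewrite 2 [Finset.prod_range_succ]
    nth_rewrite 3 [Finset.prod_range_succ]
    linear_combination (colA q (k + 1) * colA q k) * ih +
      (q * ((∏ j ∈ Finset.range (k + 1), colB q j) * ∏ j ∈ Finset.range k, colB q j)) * h

/-- The argument of the logarithm in the inverse formulas (without the mass). -/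
noncomputable def detRatio (k : ℕ) (a f : ℕ → ℝ) : ℝ :=
  (∏ j ∈ Finset.range k, a j) * |(csvA (k + 1) a f).det| * |(csvA k a f).det| /
    (|(csvB (k + 1) a f).det| * |(csvB k a f).det|)

theorem detRatio_congr {f' : ℕ → ℝ} (h : ∀ i ≤ k, f i = f' i) :
    detRatio k a f = detRatio k a f' := by
  have hA : ∀ n ≤ k + 1, csvA n a f = csvA n a f' := fun n hn => by
    ext i j
    simp [csvA, h i (by omega)]
  have hB : ∀ n ≤ k + 1, csvB n a f = csvB n a f' := fun n hn => by
    ext i j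
    simp [csvB, h i (by omega)]
  simp only [detRatio, hA k (by omega), hA (k + 1) le_rfl, hB k (by omega), hB (k + 1) le_rfl]

theorem detRatio_zero (hf : 0 < f 0) : detRatio 0 a f = f 0 := by
  simp [detRatio, csvA, csvB, Matrix.det_unique, abs_of_pos hf]

/-- The row factors cancel between numerator and denominator. The extra `a 0 * f 0 ^ 2` in the
numerator is compensated by the column factors, whose ratio is `1 / (a 0 * f 0 ^ 2)`. -/
theorem detRatio_succ (ha : 0 < a 0) (hf : f 0 ≠ 0)
    (hd : ∀ i < k + 1, a 0 * f 0 - a (i + 1) * f (i + 1) ≠ 0) :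
    detRatio (k + 1) a f = detRatio k (fun i => a (i + 1)) (reduce a f) := by
  have hd' : ∀ i < k, a 0 * f 0 - a (i + 1) * f (i + 1) ≠ 0 := fun i hi => hd i (by omega)
  have hq : 1 / (a 0 * f 0 ^ 2) ≠ 0 := by positivity
  have hcol := congrArg abs (prod_col_mul_prod_col (1 / (a 0 * f 0 ^ 2)) k)
  simp only [abs_mul] at hcol
  rw [detRatio, det_csvA_succ ha.ne' hf hd, det_csvA_succ ha.ne' hf hd',
    det_csvB_succ ha.ne' hf hd, det_csvB_succ ha.ne' hf hd', detRatio,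
    Finset.prod_range_succ']
  have hD : ∀ n, (∀ i < n, a 0 * f 0 - a (i + 1) * f (i + 1) ≠ 0) →
      |∏ i : Fin n, (a 0 * f 0 - a (i + 1) * f (i + 1))| ≠ 0 := fun n hn =>
    abs_ne_zero.2 (Finset.prod_ne_zero_iff.2 fun i _ => hn i i.2)
  have hB : ∀ n, |∏ j ∈ Finset.range n, colB (1 / (a 0 * f 0 ^ 2)) j| ≠ 0 := fun n =>
    abs_ne_zero.2 (Finset.prod_ne_zero_iff.2 fun i _ => by
      unfold colB; split_ifs; exacts [by norm_num, neg_ne_zero.2 hq])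
  have h1 := hD _ hd
  have h2 := hD _ hd'
  have h3 := hB k
  have h4 := hB (k + 1)
  simp only [Fin.prod_univ_eq_prod_range (fun j => colA (1 / (a 0 * f 0 ^ 2)) j),
    Fin.prod_univ_eq_prod_range (fun j => colB (1 / (a 0 * f 0 ^ 2)) j), abs_mul]
  generalize |∏ i : Fin k, (a 0 * f 0 - a (i + 1) * f (i + 1))| = d1 at *
  generalize |∏ i : Fin (k + 1), (a 0 * f 0 - a (i + 1) * f (i + 1))| = d2 at *
  generalize |∏ j ∈ Finset.range k, colB (1 / (a 0 * f 0 ^ 2)) j| = b1 at *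
  generalize |∏ j ∈ Finset.range (k + 1), colB (1 / (a 0 * f 0 ^ 2)) j| = b2 at *
  generalize |∏ j ∈ Finset.range k, colA (1 / (a 0 * f 0 ^ 2)) j| = a1 at *
  generalize |∏ j ∈ Finset.range (k + 1), colA (1 / (a 0 * f 0 ^ 2)) j| = a2 at *
  have hf' : |f 0| ≠ 0 := abs_ne_zero.2 hf
  have hcol' : a2 * a1 * (a 0 * |f 0| ^ 2) = b2 * b1 := by
    rw [hcol, abs_of_nonneg (by positivity), sq_abs]
    field_simp
  generalize |(csvA (k + 1) (fun i => a (i + 1)) (reduce a f)).det| = A2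
  generalize |(csvA k (fun i => a (i + 1)) (reduce a f)).det| = A1
  generalize |(csvB (k + 1) (fun i => a (i + 1)) (reduce a f)).det| = B2
  generalize |(csvB k (fun i => a (i + 1)) (reduce a f)).det| = B1
  rw [show (∏ j ∈ Finset.range k, a (j + 1)) * a 0 * (|f 0| * d2 * a2 * A2) *
      (|f 0| * d1 * a1 * A1) = (d2 * d1 * (b2 * b1)) *
        ((∏ j ∈ Finset.range k, a (j + 1)) * A2 * A1) by rw [← hcol']; ring,
    show d2 * b2 * B2 * (d1 * b1 * B1) = (d2 * d1 * (b2 * b1)) * (B2 * B1) by ring,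
    mul_div_mul_left _ _ (by positivity)]

end

/-! ### Iterated removal of peakons -/

/-- The pair that remains after the removal of `k` peakons with parameters `a 0, …, a (k - 1)`. -/
noncomputable def stage (a : ℕ → ℝ) (s : ℝ[X] × ℝ[X]) : ℕ → ℝ[X] × ℝ[X]
  | 0 => s
  | k + 1 => strip (a k) (stage a s k)

/-- The determinants are reduced at the first node, whereas `stage` recurses at the last. -/
theorem stage_succ' (a : ℕ → ℝ) (s : ℝ[X] × ℝ[X]) (k : ℕ) :
    stage a s (k + 1) = stage (fun i => a (i + 1)) (strip (a 0) s) k := by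
  induction k with
  | zero => rfl
  | succ k ih => rw [stage, ih, stage]

theorem IsStage.stage {σ : ℝ} (hσ : 0 < σ) {l k : ℕ} {a : ℕ → ℝ} {s : ℝ[X] × ℝ[X]}
    (h : IsStage σ (l + k) s) (ha : ∀ i < k, 0 < a i) : IsStage σ l (stage a s k) := by
  induction k generalizing l with
  | zero => exact h
  | succ k ih =>
    exact (ih (l := l + 1) (by rwa [add_assoc, add_comm 1]) fun i hi => ha i (by omega)).strip
      (ha k (by omega)) hσ

/-- For distinct parameters the determinantal formulas give the values `h`. -/
theorem quot_stage_eq_detRatio {σ : ℝ} (hσ : 0 < σ) {l k : ℕ} {a : ℕ → ℝ} {s : ℝ[X] × ℝ[X]}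
    (h : IsStage σ (l + k + 1) s) (ha : ∀ i ≤ k, 0 < a i) (hinj : Set.InjOn a (Set.Iic k)) :
    quot (a k) (stage a s k) = detRatio k a fun i => quot (a i) s := by
  induction k generalizing a s with
  | zero =>
    have h0 : 0 < quot (a 0) s := h.quot_pos (by linarith [ha 0 le_rfl])
    exact (detRatio_zero (f := fun i => quot (a i) s) h0).symm
  | succ k ih =>
    have h0 := ha 0 (by omega)
    have hq := h.quot_pos (y := a 0) (by linarith)
    -- Strict monotonicity of `y F` separates distinct nodes.
    have hne : ∀ i < k + 1, a 0 * quot (a 0) s - a (i + 1) * quot (a (i + 1)) s ≠ 0 := by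
      intro i hi h1
      have := (h.strictMonoOn hσ).injOn (ha 0 (by omega)) (ha (i + 1) (by omega))
        (sub_eq_zero.1 h1)
      have := hinj (Set.mem_Iic.2 (by omega)) (Set.mem_Iic.2 (by omega)) this
      omega
    rw [detRatio_succ h0 hq.ne' hne, stage_succ',
      ih (h.strip h0 hσ) (fun i hi => ha (i + 1) (by omega)) fun i hi j hj hij => by
        simpa using hinj (Set.mem_Iic.2 (Nat.succ_le_succ hi)) (Set.mem_Iic.2 (Nat.succ_le_succ hj)) hij]
    -- It remains to identify the reduced values with `Q₁ / P₁` at the remaining nodes.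
    refine (detRatio_congr fun i hi => ?_).symm
    have hPe := h.fst_pos (a 0) (by linarith)
    have hQe := h.snd_pos (by omega) (a 0) (by linarith)
    have hai := ha (i + 1) (by omega)
    have hP := h.fst_pos (a (i + 1)) (by linarith)
    have h1 := eval_strip_fst h0.ne' hPe.ne' hQe.ne' (a (i + 1))
    have h2 := eval_strip_snd hPe.ne' (a (i + 1))
    have hP' := (h.strip h0 hσ).fst_pos (a (i + 1)) (by linarith)
    have hsub : a 0 - a (i + 1) ≠ 0 := sub_ne_zero.2 fun heq => by
      have := hinj (Set.mem_Iic.2 (by omega)) (Set.mem_Iic.2 (by omega)) heq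
      omega
    have hQ' : quot (a (i + 1)) s * s.1.eval (a (i + 1)) = s.2.eval (a (i + 1)) :=
      div_mul_cancel₀ _ hP.ne'
    have hg : 1 / (a 0 * quot (a 0) s) * (a 0 * quot (a 0) s) = 1 :=
      one_div_mul_cancel (by positivity)
    rw [reduce, quot.eq_1 (a (i + 1)) (MCH.strip _ _), div_eq_div_iff (hne i (by omega)) hP'.ne']
    refine mul_left_cancel₀ hsub ?_
    generalize 1 / (a 0 * quot (a 0) s) = g at *
    linear_combination a 0 * quot (a 0) s * (quot (a (i + 1)) s - quot (a 0) s) * h1 -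
      (a 0 * quot (a 0) s - a (i + 1) * quot (a (i + 1)) s) * h2 +
      a 0 * a (i + 1) * s.2.eval (a (i + 1)) * (quot (a 0) s - quot (a (i + 1)) s) * hg +
      a 0 * quot (a 0) s * (a 0 - a (i + 1)) * hQ'

end MCH

/-! ### Continuity in the masses and evolution in time. -/

namespace MCH

open Filter Topology Polynomial

/-! ### Interpolation of families of polynomials -/

/-- Nodes avoiding `S` transfer limits and derivatives to the exceptional points of `S`, where the
formulas for `strip` read `0 = 0`. -/
theorem exists_interpolation (N : ℕ) {S : Set ℝ} (hS : S.Finite) :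
    ∃ (t : Finset ℝ) (w : ℝ → ℝ[X]), (∀ x ∈ t, x ∉ S) ∧
      ∀ f : ℝ[X], f.natDegree ≤ N → ∀ y, f.eval y = ∑ x ∈ t, (w x).eval y * f.eval x := by
  obtain ⟨t, ht, hcard⟩ := hS.infinite_compl.exists_subset_card_eq (N + 1)
  refine ⟨t, Lagrange.basis t id, fun x hx => ht hx, fun f hf y => ?_⟩
  have hdeg : f.degree < t.card := by
    rw [hcard]
    exact degree_le_natDegree.trans_lt (by exact_mod_cast Nat.lt_succ_of_le hf)
  conv_lhs => rw [Lagrange.eq_interpolate (v := id) (Set.injOn_id _) hdeg]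
  simp [Lagrange.interpolate_apply, eval_finsetSum, mul_comm]

theorem hasDerivAt_eval_of_ne {N : ℕ} {f : ℝ → ℝ[X]} (hN : ∀ s, (f s).natDegree ≤ N) {g : ℝ → ℝ}
    {e t : ℝ} (he : e ≠ 0) (hg : ContinuousAt g e)
    (h : ∀ y, y ≠ 0 → y ≠ e → HasDerivAt (fun s => (f s).eval y) (g y) t) :
    HasDerivAt (fun s => (f s).eval e) (g e) t := by
  obtain ⟨T, w, hT, hw⟩ := exists_interpolation N (Set.toFinite {0, e})
  have hder : ∀ y, HasDerivAt (fun s => (f s).eval y) (∑ x ∈ T, (w x).eval y * g x) t := by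
    intro y
    simp only [fun s => hw (f s) (hN s) y]
    refine HasDerivAt.fun_sum fun x hx => (h x ?_ ?_).const_mul _
    · exact fun hx0 => hT x hx (by simp [hx0])
    · exact fun hx0 => hT x hx (by simp [hx0])
  have heq : g e = ∑ x ∈ T, (w x).eval e * g x := by
    have hc : Continuous fun y => ∑ x ∈ T, (w x).eval y * g x :=
      continuous_finsetSum _ fun x _ => (w x).continuous.mul continuous_const
    refine tendsto_nhds_unique (hg.tendsto.mono_left (nhdsWithin_le_nhds (s := {e}ᶜ)))
      (((hc.tendsto e).mono_left nhdsWithin_le_nhds).congr' ?_)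
    have h0 : ∀ᶠ y in 𝓝[≠] e, y ≠ 0 := (eventually_ne_nhds he).filter_mono nhdsWithin_le_nhds
    filter_upwards [h0, self_mem_nhdsWithin] with y hy0 hye
    exact (hder y).unique (h y hy0 hye)
  rw [heq]
  exact hder e

theorem tendsto_eval {ι : Type*} {L : Filter ι} {N : ℕ} {f : ι → ℝ[X]} {f₀ : ℝ[X]}
    (hN : ∀ i, (f i).natDegree ≤ N) (hN₀ : f₀.natDegree ≤ N) {e : ℝ}
    (h : ∀ y, y ≠ e → Tendsto (fun i => (f i).eval y) L (𝓝 (f₀.eval y))) {z : ι → ℝ} {z₀ : ℝ}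
    (hz : Tendsto z L (𝓝 z₀)) : Tendsto (fun i => (f i).eval (z i)) L (𝓝 (f₀.eval z₀)) := by
  obtain ⟨T, w, hT, hw⟩ := exists_interpolation N (Set.finite_singleton e)
  rw [hw f₀ hN₀]
  refine Tendsto.congr (fun i => (hw (f i) (hN i) (z i)).symm) ?_
  exact tendsto_finsetSum _ fun x hx =>
    (((w x).continuous.tendsto z₀).comp hz).mul (h x fun hx0 => hT x hx (by simp [hx0]))

/-! ### Continuity in the masses -/

/-- Convergence of pairs of polynomials of bounded degree. -/
structure StageTendsto {ι : Type*} (N : ℕ) (L : Filter ι) (f : ι → ℝ[X] × ℝ[X])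
    (f₀ : ℝ[X] × ℝ[X]) : Prop where
  natDegree_fst : ∀ i, (f i).1.natDegree ≤ N
  natDegree_snd : ∀ i, (f i).2.natDegree ≤ N
  natDegree_fst_lim : f₀.1.natDegree ≤ N
  natDegree_snd_lim : f₀.2.natDegree ≤ N
  tendsto_fst : ∀ y, Tendsto (fun i => (f i).1.eval y) L (𝓝 (f₀.1.eval y))
  tendsto_snd : ∀ y, Tendsto (fun i => (f i).2.eval y) L (𝓝 (f₀.2.eval y))

namespace StageTendsto

variable {ι : Type*} {N : ℕ} {L : Filter ι} {f : ι → ℝ[X] × ℝ[X]} {f₀ : ℝ[X] × ℝ[X]}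

theorem tendsto_quot (h : StageTendsto N L f f₀) {e : ι → ℝ} {e₀ : ℝ} (he : Tendsto e L (𝓝 e₀))
    (h0 : f₀.1.eval e₀ ≠ 0) : Tendsto (fun i => quot (e i) (f i)) L (𝓝 (quot e₀ f₀)) :=
  (tendsto_eval (e := 0) h.natDegree_snd h.natDegree_snd_lim (fun y _ => h.tendsto_snd y) he).div
    (tendsto_eval (e := 0) h.natDegree_fst h.natDegree_fst_lim (fun y _ => h.tendsto_fst y) he) h0

/-- Off `e₀` the explicit quotients converge; interpolation covers `y = e₀`, which matters because
masses may coincide in the limit. -/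
theorem strip (h : StageTendsto N L f f₀) {e : ι → ℝ} {e₀ : ℝ} (he : Tendsto e L (𝓝 e₀))
    (he0 : 0 < e₀) {σ : ℝ} (hσ : 0 < σ) {l : ℕ} (hf₀ : IsStage σ (l + 1) f₀)
    (hf : ∀ᶠ i in L, IsStage σ (l + 1) (f i)) :
    StageTendsto N L (fun i => strip (e i) (f i)) (strip e₀ f₀) := by
  have hP := hf₀.fst_pos e₀ (by linarith)
  have hQ := hf₀.snd_pos l.succ_pos e₀ (by linarith)
  have hq := hf₀.quot_pos (y := e₀) (by linarith)
  have htq := h.tendsto_quot he hP.ne'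
  have hpos : ∀ᶠ i in L, 0 < e i := he.eventually_const_lt he0
  have hd := fun i => natDegree_strip (e := e i) (h.natDegree_fst i) (h.natDegree_snd i)
  have hd₀ := natDegree_strip (e := e₀) h.natDegree_fst_lim h.natDegree_snd_lim
  refine ⟨fun i => (hd i).1, fun i => (hd i).2, hd₀.1, hd₀.2, fun y => ?_, fun y => ?_⟩
  · refine tendsto_eval (fun i => (hd i).1) hd₀.1 (e := e₀) (fun y hy => ?_) tendsto_const_nhds
    have hsub : e₀ - y ≠ 0 := sub_ne_zero.2 hy.symm
    rw [eq_div_of_mul_eq hsub ((mul_comm _ _).trans (eval_strip_fst he0.ne' hP.ne' hQ.ne' y))]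
    refine Tendsto.congr' ?_ ((he.mul ((h.tendsto_fst y).sub (((tendsto_const_nhds (x := (1 : ℝ))).div
      (he.mul htq) (by positivity)).mul ((h.tendsto_snd y).const_mul y)))).div
      (he.sub_const y) hsub)
    filter_upwards [hpos, hf, he.eventually_ne hy.symm] with i hi hfi hne
    exact (eq_div_of_mul_eq (sub_ne_zero.2 hne) ((mul_comm _ _).trans
      (eval_strip_fst hi.ne' (hfi.fst_pos _ (by linarith)).ne'
        (hfi.snd_pos l.succ_pos _ (by linarith)).ne' y))).symm
  · refine tendsto_eval (fun i => (hd i).2) hd₀.2 (e := e₀) (fun y hy => ?_) tendsto_const_nhds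
    have hsub : e₀ - y ≠ 0 := sub_ne_zero.2 hy.symm
    rw [eq_div_of_mul_eq hsub ((mul_comm _ _).trans (eval_strip_snd hP.ne' y))]
    refine Tendsto.congr' ?_ ((he.mul ((h.tendsto_snd y).sub
      (htq.mul (h.tendsto_fst y)))).div (he.sub_const y) hsub)
    filter_upwards [hpos, hf, he.eventually_ne hy.symm] with i hi hfi hne
    exact (eq_div_of_mul_eq (sub_ne_zero.2 hne) ((mul_comm _ _).trans
      (eval_strip_snd (hfi.fst_pos _ (by linarith)).ne' y))).symm

end StageTendsto

theorem stageTendsto_stage {ι : Type*} {N : ℕ} {L : Filter ι} {s : ℝ[X] × ℝ[X]}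
    (h1 : s.1.natDegree ≤ N) (h2 : s.2.natDegree ≤ N) {σ : ℝ} (hσ : 0 < σ) {l k : ℕ}
    (h : IsStage σ (l + k) s) {a : ι → ℕ → ℝ} {a₀ : ℕ → ℝ}
    (ha : ∀ j < k, Tendsto (fun i => a i j) L (𝓝 (a₀ j))) (hpos : ∀ j < k, 0 < a₀ j) :
    StageTendsto N L (fun i => stage (a i) s k) (stage a₀ s k) := by
  induction k generalizing l with
  | zero => exact ⟨fun _ => h1, fun _ => h2, h1, h2, fun _ => tendsto_const_nhds,
      fun _ => tendsto_const_nhds⟩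
  | succ k ih =>
    have hk : IsStage σ (l + 1 + k) s := by rwa [add_assoc, add_comm 1]
    refine (ih (l := l + 1) hk (fun j hj => ha j (by omega)) fun j hj => hpos j (by omega)).strip
      (ha k (by omega)) (hpos k (by omega)) hσ (hk.stage hσ fun j hj => hpos j (by omega)) ?_
    have : ∀ᶠ i in L, ∀ j ∈ Finset.range k, 0 < a i j := by
      rw [eventually_all_finset]
      intro j hj
      have hj := Finset.mem_range.1 hj
      exact (ha j (by omega)).eventually_const_lt (hpos j (by omega))
    filter_upwards [this] with i hi
    exact hk.stage hσ fun j hj => hi j (Finset.mem_range.2 hj)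

/-! ### Time evolution -/

/-- The evolution of the pair `(P, Q)`, with `H = Q(0) / P(0)` and a parameter `Γ`:
`Q̇ = (-2/y + 2HΓ) Q + (2H/y) P` and `Ṗ = 2Γ Q - 2HΓ P`. -/
structure Evolves (N : ℕ) (f : ℝ → ℝ[X] × ℝ[X]) (Γ t : ℝ) : Prop where
  natDegree_fst : ∀ s, (f s).1.natDegree ≤ N
  natDegree_snd : ∀ s, (f s).2.natDegree ≤ N
  deriv_fst : ∀ y, y ≠ 0 → HasDerivAt (fun s => (f s).1.eval y)
    (2 * Γ * (f t).2.eval y - 2 * quot 0 (f t) * Γ * (f t).1.eval y) t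
  deriv_snd : ∀ y, y ≠ 0 → HasDerivAt (fun s => (f s).2.eval y)
    ((-2 / y + 2 * quot 0 (f t) * Γ) * (f t).2.eval y + 2 * quot 0 (f t) / y * (f t).1.eval y) t

namespace Evolves

variable {N : ℕ} {f : ℝ → ℝ[X] × ℝ[X]} {Γ t σ e : ℝ} {l : ℕ}

/-- The factor after `h` is a peakon velocity: with `H = h + A` and `Γ = B` it equals `2 g A + 2 h B
+ 4 A B`. -/
theorem hasDerivAt_quot (h : Evolves N f Γ t) (hσ : 0 < σ) (hf : IsStage σ (l + 1) (f t))
    (he : 0 < e) : HasDerivAt (fun s => quot e (f s)) (quot e (f t) *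
      (2 * (1 / (e * quot e (f t))) * (quot 0 (f t) - quot e (f t)) +
        2 * Γ * (2 * quot 0 (f t) - quot e (f t)))) t := by
  have hP := hf.fst_pos e (by linarith)
  have hQ := hf.snd_pos l.succ_pos e (by linarith)
  refine ((h.deriv_snd e he.ne').fun_div (h.deriv_fst e he.ne') hP.ne').congr_deriv ?_
  rw [quot.eq_1 e]
  field_simp
  ring

theorem quot_zero_strip {s : ℝ[X] × ℝ[X]} (hs : IsStage σ (l + 1) s) (hσ : 0 < σ) (he : 0 < e) :
    quot 0 (MCH.strip e s) = quot 0 s - quot e s := by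
  have hP := hs.fst_pos e (by linarith)
  have hQ := hs.snd_pos l.succ_pos e (by linarith)
  have hP0 := hs.fst_pos 0 (by linarith)
  have h1 := eval_strip_fst he.ne' hP.ne' hQ.ne' 0
  have h2 := eval_strip_snd hP.ne' 0
  simp only [sub_zero, zero_mul, mul_zero] at h1 h2
  rw [quot.eq_1 0, quot.eq_1 0, mul_left_cancel₀ he.ne' h1, mul_left_cancel₀ he.ne' h2]
  field_simp

/-- A compatibility computation: `H` drops by `h`, `Γ` grows by `g`, and the derivatives of `h` and
`g` absorb the rest. The case `y = e` follows by interpolation. -/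
theorem strip (h : Evolves N f Γ t) (hσ : 0 < σ) (hf : ∀ s, IsStage σ (l + 1) (f s))
    (he : 0 < e) :
    Evolves N (fun s => strip e (f s)) (Γ + 1 / (e * quot e (f t))) t := by
  have hP := fun s => (hf s).fst_pos e (by linarith)
  have hQ := fun s => (hf s).snd_pos l.succ_pos e (by linarith)
  have hq := (hf t).quot_pos (y := e) (by linarith)
  have hdq := h.hasDerivAt_quot hσ (hf t) he
  have hH := quot_zero_strip (hf t) hσ he
  have hd := fun s => natDegree_strip (e := e) (h.natDegree_fst s) (h.natDegree_snd s)
  have hg : 1 / (e * quot e (f t)) * (e * quot e (f t)) = 1 := one_div_mul_cancel (by positivity)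
  have hfst : ∀ y, y ≠ 0 → y ≠ e → HasDerivAt (fun s => (MCH.strip e (f s)).1.eval y)
      (2 * (Γ + 1 / (e * quot e (f t))) * (MCH.strip e (f t)).2.eval y -
        2 * (quot 0 (f t) - quot e (f t)) * (Γ + 1 / (e * quot e (f t))) *
          (MCH.strip e (f t)).1.eval y) t := by
    intro y hy0 hye
    have hsub : e - y ≠ 0 := sub_ne_zero.2 hye.symm
    have h1 := fun s => eval_strip_fst he.ne' (hP s).ne' (hQ s).ne' y
    have h2 := eval_strip_snd (hP t).ne' y
    simp only [fun s => eq_div_of_mul_eq hsub ((mul_comm _ _).trans (h1 s))]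
    have hdg : HasDerivAt (fun s => 1 / (e * quot e (f s))) (-(1 / (e * quot e (f t))) *
        (2 * (1 / (e * quot e (f t))) * (quot 0 (f t) - quot e (f t)) +
        2 * Γ * (2 * quot 0 (f t) - quot e (f t)))) t := by
      refine ((hasDerivAt_const t (1 : ℝ)).fun_div (hdq.const_mul e) (by positivity)).congr_deriv ?_
      field_simp
      ring
    refine ((((h.deriv_fst y hy0).sub (hdg.mul ((h.deriv_snd y hy0).const_mul y))).const_mul
      e).div_const (e - y)).congr_deriv ?_
    rw [eq_div_of_mul_eq hsub ((mul_comm _ _).trans h2), div_eq_iff hsub]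
    generalize quot e (f t) = h at *
    have := he.ne'
    have := hq.ne'
    field_simp
    ring
  have hsnd : ∀ y, y ≠ 0 → y ≠ e → HasDerivAt (fun s => (MCH.strip e (f s)).2.eval y)
      ((-2 / y + 2 * (quot 0 (f t) - quot e (f t)) * (Γ + 1 / (e * quot e (f t)))) *
        (MCH.strip e (f t)).2.eval y + 2 * (quot 0 (f t) - quot e (f t)) / y *
          (MCH.strip e (f t)).1.eval y) t := by
    intro y hy0 hye
    have hsub : e - y ≠ 0 := sub_ne_zero.2 hye.symm
    have h1 := eval_strip_fst he.ne' (hP t).ne' (hQ t).ne' y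
    have h2 := fun s => eval_strip_snd (hP s).ne' y
    simp only [fun s => eq_div_of_mul_eq hsub ((mul_comm _ _).trans (h2 s))]
    refine ((((h.deriv_snd y hy0).sub (hdq.mul (h.deriv_fst y hy0))).const_mul
      e).div_const (e - y)).congr_deriv ?_
    rw [eq_div_of_mul_eq hsub ((mul_comm _ _).trans h1), div_eq_iff hsub]
    generalize quot e (f t) = h at *
    have := he.ne'
    have := hq.ne'
    field_simp
    ring
  refine ⟨fun s => (hd s).1, fun s => (hd s).2, fun y hy0 => ?_, fun y hy0 => ?_⟩
  · rw [hH]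
    rcases eq_or_ne y e with hye | hye
    · rw [hye]
      exact hasDerivAt_eval_of_ne (fun s => (hd s).1) he.ne'
        (g := fun y => 2 * (Γ + 1 / (e * quot e (f t))) * (MCH.strip e (f t)).2.eval y -
        2 * (quot 0 (f t) - quot e (f t)) * (Γ + 1 / (e * quot e (f t))) *
          (MCH.strip e (f t)).1.eval y) (by fun_prop) hfst
    · exact hfst y hy0 hye
  · rw [hH]
    rcases eq_or_ne y e with hye | hye
    · have := he.ne'
      rw [hye]
      exact hasDerivAt_eval_of_ne (fun s => (hd s).2) he.ne'
        (g := fun y => (-2 / y + 2 * (quot 0 (f t) - quot e (f t)) *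
          (Γ + 1 / (e * quot e (f t)))) * (MCH.strip e (f t)).2.eval y +
          2 * (quot 0 (f t) - quot e (f t)) / y * (MCH.strip e (f t)).1.eval y)
        (by fun_prop (disch := assumption)) hsnd
    · exact hsnd y hy0 hye

end Evolves
end MCH

/-! ### From ordered peakon trajectories to distributional solutions. -/

namespace MCH

open Filter Topology MeasureTheory

/-! ### The peakon profile -/

theorem continuous_peakonProfile (n : ℕ) (m x : ℕ → ℝ) : Continuous (peakonProfile n m x) := by
  unfold peakonProfile
  fun_prop

theorem IsTest.deriv {ψ : ℝ → ℝ} (h : IsTest ψ) : IsTest (deriv ψ) :=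
  ⟨((contDiff_succ_iff_deriv (n := (⊤ : ℕ∞))).1 (by simpa using h.1)).2.2, h.2.deriv⟩

theorem IsTest.hasDerivAt {ψ : ℝ → ℝ} (h : IsTest ψ) (y : ℝ) : HasDerivAt ψ (_root_.deriv ψ y) y :=
  ((h.1.differentiable (by simp)) y).hasDerivAt

theorem IsTest.integrable_exp_mul {ψ : ℝ → ℝ} (h : IsTest ψ) {f : ℝ → ℝ} (hf : Continuous f) :
    Integrable fun y => f y * ψ y :=
  (hf.mul h.1.continuous).integrable_of_hasCompactSupport h.2.mul_left

theorem IsTest.tendsto_zero {ψ : ℝ → ℝ} (h : IsTest ψ) (f : ℝ → ℝ) :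
    Tendsto (fun y => f y * ψ y) atTop (𝓝 0) ∧ Tendsto (fun y => f y * ψ y) atBot (𝓝 0) := by
  have : (fun y => f y * ψ y) =ᶠ[cocompact ℝ] fun _ => 0 := by
    filter_upwards [h.2.isCompact.compl_mem_cocompact] with y hy
    rw [image_eq_zero_of_notMem_tsupport hy, mul_zero]
  have := (tendsto_congr' this).2 tendsto_const_nhds
  exact ⟨this.mono_left atTop_le_cocompact, this.mono_left atBot_le_cocompact⟩

/-- `e^{-|y - a|} / 2` is the fundamental solution of `1 - ∂²`. -/
theorem integral_exp_neg_abs_mul {ψ : ℝ → ℝ} (h : IsTest ψ) (a : ℝ) :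
    ∫ y, Real.exp (-|y - a|) * (ψ y - deriv (deriv ψ) y) = 2 * ψ a := by
  have hsplit : ∀ f : ℝ → ℝ, Integrable f →
      ∫ y, f y = (∫ y in Set.Iic a, f y) + ∫ y in Set.Ioi a, f y := fun f hf =>
    (intervalIntegral.integral_Iic_add_Ioi hf.integrableOn hf.integrableOn).symm
  have hint : ∀ f : ℝ → ℝ, Continuous f → Integrable fun y => f y * (ψ y - deriv (deriv ψ) y) :=
    fun f hf => by
      simp only [mul_sub]
      exact (h.integrable_exp_mul hf).sub (h.deriv.deriv.integrable_exp_mul hf)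
  have hd1 := fun y => h.hasDerivAt y
  have hd2 := fun y => h.deriv.hasDerivAt y
  rw [hsplit _ (hint _ (by fun_prop))]
  have hE1 : ∀ y, HasDerivAt (fun y => Real.exp (y - a)) (Real.exp (y - a)) y := fun y => by
    simpa using ((hasDerivAt_id y).sub_const a).exp
  have hE2 : ∀ y, HasDerivAt (fun y => Real.exp (a - y)) (-Real.exp (a - y)) y := fun y => by
    simpa using ((hasDerivAt_id y).const_sub a).exp
  have hl : ∫ y in Set.Iic a, Real.exp (-|y - a|) * (ψ y - deriv (deriv ψ) y) =
      ψ a - deriv ψ a := by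
    rw [setIntegral_congr_fun measurableSet_Iic (g := fun y =>
      Real.exp (y - a) * (ψ y - deriv (deriv ψ) y)) fun y hy => by
        simp [abs_of_nonpos (sub_nonpos.2 (Set.mem_Iic.1 hy))]]
    -- The antiderivative is `e^{y-a} (ψ - ψ')` on the left and `-e^{a-y} (ψ + ψ')` on the right;
    -- the `ψ'` terms at `a` cancel in the sum.
    rw [integral_Iic_of_hasDerivAt_of_tendsto' (m := 0)
      (f := fun y => Real.exp (y - a) * ψ y - Real.exp (y - a) * deriv ψ y)
      (fun y _ => (((hE1 y).mul (hd1 y)).sub ((hE1 y).mul (hd2 y))).congr_deriv (by ring))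
      (hint _ (by fun_prop)).integrableOn
      (by simpa using (h.tendsto_zero _).2.sub (h.deriv.tendsto_zero _).2)]
    simp
  have hr : ∫ y in Set.Ioi a, Real.exp (-|y - a|) * (ψ y - deriv (deriv ψ) y) =
      ψ a + deriv ψ a := by
    rw [setIntegral_congr_fun measurableSet_Ioi (g := fun y =>
      Real.exp (a - y) * (ψ y - deriv (deriv ψ) y)) fun y hy => by
        simp [abs_of_pos (sub_pos.2 (Set.mem_Ioi.1 hy))]]
    rw [integral_Ioi_of_hasDerivAt_of_tendsto' (m := 0)
      (f := fun y => -(Real.exp (a - y) * ψ y) - Real.exp (a - y) * deriv ψ y)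
      (fun y _ => (((hE2 y).mul (hd1 y)).neg.sub ((hE2 y).mul (hd2 y))).congr_deriv (by ring))
      (hint _ (by fun_prop)).integrableOn
      (by simpa using (h.tendsto_zero _).1.neg.sub (h.deriv.tendsto_zero _).1)]
    simp
    ring
  rw [hl, hr]
  ring

/-- The momentum `∑ⱼ 2 mⱼ δ_{xⱼ}` of a multipeakon. -/
noncomputable def peakonMeasure (n : ℕ) (m x : ℕ → ℝ) : Measure ℝ :=
  ∑ j ∈ Finset.Icc 1 n, ENNReal.ofReal (2 * m j) • Measure.dirac (x j)

instance (n : ℕ) (m x : ℕ → ℝ) : IsFiniteMeasure (peakonMeasure n m x) := by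
  refine ⟨?_⟩
  simp only [peakonMeasure, Measure.finsetSum_apply, ENNReal.sum_lt_top, Measure.smul_apply,
    measure_univ, smul_eq_mul, mul_one]
  exact fun _ _ => ENNReal.ofReal_lt_top

section

variable {n : ℕ} {m x : ℕ → ℝ}

theorem integrable_peakonMeasure (f : ℝ → ℝ) : Integrable f (peakonMeasure n m x) := by
  refine integrable_finsetSum_measure.2 fun j _ => ?_
  exact (integrable_dirac (by simp)).smul_measure ENNReal.ofReal_ne_top

theorem integral_peakonMeasure (hm : ∀ j ∈ Set.Icc 1 n, 0 < m j) (f : ℝ → ℝ) :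
    ∫ y, f y ∂(peakonMeasure n m x) = ∑ j ∈ Finset.Icc 1 n, 2 * m j * f (x j) := by
  rw [peakonMeasure, integral_finsetSum_measure fun j _ =>
    (integrable_dirac (by simp)).smul_measure ENNReal.ofReal_ne_top]
  refine Finset.sum_congr rfl fun j hj => ?_
  have := hm j (Finset.mem_Icc.1 hj)
  rw [integral_smul_measure, integral_dirac, ENNReal.toReal_ofReal (by positivity), smul_eq_mul]

theorem isMomentum_peakonProfile (hm : ∀ j ∈ Set.Icc 1 n, 0 < m j) :
    IsMomentum (peakonProfile n m x) (peakonMeasure n m x) := by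
  intro ψ hψ
  rw [integral_peakonMeasure hm]
  simp only [peakonProfile, Finset.sum_mul]
  rw [integral_finsetSum]
  · refine Finset.sum_congr rfl fun j _ => ?_
    simp only [mul_assoc]
    rw [integral_const_mul, integral_exp_neg_abs_mul hψ]
    ring
  · intro j _
    simp only [mul_sub]
    have hf : Continuous fun y => m j * Real.exp (-|y - x j|) := by fun_prop
    exact (hψ.integrable_exp_mul hf).sub (hψ.deriv.deriv.integrable_exp_mul hf)

/-- The derivative of `y ↦ e^{-|y - a|}` off the point `a`. -/
noncomputable def expDeriv (a y : ℝ) : ℝ :=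
  if y < a then Real.exp (y - a) else -Real.exp (a - y)

theorem hasDerivAt_exp_neg_abs {a y : ℝ} (h : y ≠ a) :
    HasDerivAt (fun y => Real.exp (-|y - a|)) (expDeriv a y) y := by
  rcases h.lt_or_gt with h | h
  · have : (fun y => Real.exp (-|y - a|)) =ᶠ[𝓝 y] fun y => Real.exp (y - a) := by
      filter_upwards [eventually_lt_nhds h] with z hz
      rw [abs_of_neg (by linarith), neg_neg]
    refine HasDerivAt.congr_of_eventuallyEq ?_ this
    simpa [expDeriv, h] using ((hasDerivAt_id y).sub_const a).exp
  · have : (fun y => Real.exp (-|y - a|)) =ᶠ[𝓝 y] fun y => Real.exp (a - y) := by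
      filter_upwards [eventually_gt_nhds h] with z hz
      rw [abs_of_pos (by linarith), neg_sub]
    refine HasDerivAt.congr_of_eventuallyEq ?_ this
    simpa [expDeriv, h.not_gt] using ((hasDerivAt_id y).const_sub a).exp

/-- The left limit of `expDeriv`. -/
noncomputable def expDerivLeft (a y : ℝ) : ℝ :=
  if y ≤ a then Real.exp (y - a) else -Real.exp (a - y)

theorem tendsto_expDeriv_right (a y : ℝ) : Tendsto (expDeriv a) (𝓝[>] y) (𝓝 (expDeriv a y)) := by
  rcases lt_or_ge y a with h | h
  · rw [expDeriv, if_pos h]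
    have hc : Continuous fun z => Real.exp (z - a) := by fun_prop
    refine ((hc.tendsto y).mono_left nhdsWithin_le_nhds).congr' ?_
    filter_upwards [nhdsWithin_le_nhds (eventually_lt_nhds h)] with z hz
    rw [expDeriv, if_pos hz]
  · rw [expDeriv, if_neg h.not_gt]
    have hc : Continuous fun z => -Real.exp (a - z) := by fun_prop
    refine ((hc.tendsto y).mono_left nhdsWithin_le_nhds).congr' ?_
    filter_upwards [self_mem_nhdsWithin] with z hz
    rw [expDeriv, if_neg (h.trans (le_of_lt hz)).not_gt]

theorem tendsto_expDeriv_left (a y : ℝ) :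
    Tendsto (expDeriv a) (𝓝[<] y) (𝓝 (expDerivLeft a y)) := by
  rcases le_or_gt y a with h | h
  · rw [expDerivLeft, if_pos h]
    have hc : Continuous fun z => Real.exp (z - a) := by fun_prop
    refine ((hc.tendsto y).mono_left nhdsWithin_le_nhds).congr' ?_
    filter_upwards [self_mem_nhdsWithin] with z hz
    rw [expDeriv, if_pos (lt_of_lt_of_le hz h)]
  · rw [expDerivLeft, if_neg h.not_ge]
    have hc : Continuous fun z => -Real.exp (a - z) := by fun_prop
    refine ((hc.tendsto y).mono_left nhdsWithin_le_nhds).congr' ?_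
    filter_upwards [nhdsWithin_le_nhds (eventually_gt_nhds h)] with z hz
    rw [expDeriv, if_neg (le_of_lt hz).not_gt]

/-- The mean of the one-sided limits of `u_x²`. -/
noncomputable def meanSq (n : ℕ) (m x : ℕ → ℝ) (y : ℝ) : ℝ :=
  ((∑ j ∈ Finset.Icc 1 n, m j * expDerivLeft (x j) y) ^ 2 +
    (∑ j ∈ Finset.Icc 1 n, m j * expDeriv (x j) y) ^ 2) / 2

theorem isMeanSqDeriv_peakonProfile (n : ℕ) (m x : ℕ → ℝ) (y : ℝ) :
    IsMeanSqDeriv (peakonProfile n m x) y (meanSq n m x y) := by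
  have hne : ∀ᶠ z in 𝓝[≠] y, ∀ j ∈ Finset.Icc 1 n, z ≠ x j := by
    rw [eventually_all_finset]
    intro j _
    rcases eq_or_ne y (x j) with h | h
    · rw [← h]
      exact self_mem_nhdsWithin
    · exact nhdsWithin_le_nhds (eventually_ne_nhds h)
  have hd : ∀ᶠ z in 𝓝[≠] y, HasDerivAt (peakonProfile n m x)
      (∑ j ∈ Finset.Icc 1 n, m j * expDeriv (x j) z) z := by
    filter_upwards [hne] with z hz
    exact HasDerivAt.fun_sum fun j hj => (hasDerivAt_exp_neg_abs (hz j hj)).const_mul _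
  refine ⟨hd.mono fun z hz => hz.differentiableAt, _, _, ?_, ?_, rfl⟩
  · refine (Tendsto.pow (tendsto_finsetSum _ fun j _ =>
      (tendsto_expDeriv_left (x j) y).const_mul (m j)) 2).congr' ?_
    filter_upwards [nhdsWithin_mono y (fun z (hz : z < y) => hz.ne) hd] with z hz
    rw [hz.deriv]
  · refine (Tendsto.pow (tendsto_finsetSum _ fun j _ =>
      (tendsto_expDeriv_right (x j) y).const_mul (m j)) 2).congr' ?_
    filter_upwards [nhdsWithin_mono y (fun z (hz : y < z) => hz.ne') hd] with z hz
    rw [hz.deriv]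

theorem sum_Icc_eq_of_mem {f : ℕ → ℝ} {j : ℕ} (hj : j ∈ Set.Icc 1 n) :
    ∑ i ∈ Finset.Icc 1 n, f i =
      ∑ i ∈ Finset.Ico 1 j, f i + f j + ∑ i ∈ Finset.Ioc j n, f i := by
  have h1 : Finset.Icc 1 n = Finset.Ico 1 j ∪ {j} ∪ Finset.Ioc j n := by
    ext i
    simp only [Finset.mem_Icc, Finset.mem_union, Finset.mem_Ico, Finset.mem_singleton,
      Finset.mem_Ioc]
    have := hj.1
    have := hj.2
    omega
  rw [h1, Finset.sum_union, Finset.sum_union, Finset.sum_singleton]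
  · simp
  · rw [Finset.disjoint_left]
    intro i hi
    simp only [Finset.mem_union, Finset.mem_Ico, Finset.mem_singleton, Finset.mem_Ioc] at hi ⊢
    omega

/-- The peakon velocities in terms of `h_j = m_j e^{x_j}` and `g_j = m_j e^{-x_j}`. -/
theorem velocity_eq (hx : StrictMonoOn x (Set.Icc 1 n)) {j : ℕ} (hj : j ∈ Set.Icc 1 n) :
    velocity n m x j =
      2 * (m j * Real.exp (-x j)) * (∑ i ∈ Finset.Ico 1 j, m i * Real.exp (x i)) +
      2 * (m j * Real.exp (x j)) * (∑ k ∈ Finset.Ioc j n, m k * Real.exp (-x k)) +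
      4 * (∑ i ∈ Finset.Ico 1 j, m i * Real.exp (x i)) *
        (∑ k ∈ Finset.Ioc j n, m k * Real.exp (-x k)) := by
  have hlt : ∀ i ∈ Finset.Ico 1 j, x i < x j := fun i hi => by
    rw [Finset.mem_Ico] at hi
    exact hx ⟨hi.1, hi.2.le.trans hj.2⟩ hj hi.2
  have hgt : ∀ k ∈ Finset.Ioc j n, x j < x k := fun k hk => by
    rw [Finset.mem_Ioc] at hk
    exact hx hj ⟨hj.1.trans hk.1.le, hk.2⟩ hk.1
  rw [velocity]
  have h1 : ∑ k ∈ (Finset.Icc 1 n).erase j, m j * m k * Real.exp (-|x j - x k|) =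
      (m j * Real.exp (-x j)) * (∑ i ∈ Finset.Ico 1 j, m i * Real.exp (x i)) +
      (m j * Real.exp (x j)) * (∑ k ∈ Finset.Ioc j n, m k * Real.exp (-x k)) := by
    have h2 := Finset.sum_erase_add (Finset.Icc 1 n)
      (fun k => m j * m k * Real.exp (-|x j - x k|)) (Finset.mem_Icc.2 hj)
    rw [sum_Icc_eq_of_mem hj] at h2
    rw [Finset.mul_sum, Finset.mul_sum]
    have h3 : ∑ i ∈ Finset.Ico 1 j, m j * m i * Real.exp (-|x j - x i|) =
        ∑ i ∈ Finset.Ico 1 j, m j * Real.exp (-x j) * (m i * Real.exp (x i)) :=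
      Finset.sum_congr rfl fun i hi => by
        rw [abs_of_pos (by linarith [hlt i hi]), show -(x j - x i) = -x j + x i by ring,
          Real.exp_add]
        ring
    have h4 : ∑ k ∈ Finset.Ioc j n, m j * m k * Real.exp (-|x j - x k|) =
        ∑ k ∈ Finset.Ioc j n, m j * Real.exp (x j) * (m k * Real.exp (-x k)) :=
      Finset.sum_congr rfl fun i hi => by
        rw [abs_of_neg (by linarith [hgt i hi]), show - -(x j - x i) = x j + -x i by ring,
          Real.exp_add]
        ring
    linarith
  have h5 : ∑ i ∈ Finset.Ico 1 j, ∑ k ∈ Finset.Ioc j n, m i * m k * Real.exp (-|x i - x k|) =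
      (∑ i ∈ Finset.Ico 1 j, m i * Real.exp (x i)) *
        (∑ k ∈ Finset.Ioc j n, m k * Real.exp (-x k)) := by
    rw [Finset.sum_mul_sum]
    refine Finset.sum_congr rfl fun i hi => Finset.sum_congr rfl fun k hk => ?_
    rw [abs_of_neg (by linarith [hlt i hi, hgt k hk]), show - -(x i - x k) = x i + -x k by ring,
      Real.exp_add]
    ring
  rw [h1, h5]
  ring

/-- Let `A'` and `B'` be the contributions to `u(x_j)` from the left and the right. Then `u = A' +
m_j + B'` and the one-sided slopes are `B' - A' ± m_j`, so the difference is `4 A' B' + 2 m_j (A' +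
B')`. -/
theorem sq_sub_meanSq (hx : StrictMonoOn x (Set.Icc 1 n)) {j : ℕ} (hj : j ∈ Set.Icc 1 n) :
    peakonProfile n m x (x j) ^ 2 - meanSq n m x (x j) = velocity n m x j := by
  have hlt : ∀ i ∈ Finset.Ico 1 j, x i < x j := fun i hi => by
    rw [Finset.mem_Ico] at hi
    exact hx ⟨hi.1, hi.2.le.trans hj.2⟩ hj hi.2
  have hgt : ∀ k ∈ Finset.Ioc j n, x j < x k := fun k hk => by
    rw [Finset.mem_Ioc] at hk
    exact hx hj ⟨hj.1.trans hk.1.le, hk.2⟩ hk.1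
  rw [velocity_eq hx hj, peakonProfile, meanSq, sum_Icc_eq_of_mem hj, sum_Icc_eq_of_mem hj,
    sum_Icc_eq_of_mem hj]
  set A := ∑ i ∈ Finset.Ico 1 j, m i * Real.exp (x i) with hA
  set B := ∑ k ∈ Finset.Ioc j n, m k * Real.exp (-x k) with hB
  have hl : ∀ i, m i * Real.exp (x i - x j) = Real.exp (-x j) * (m i * Real.exp (x i)) := fun i => by
    rw [show x i - x j = -x j + x i by ring, Real.exp_add]; ring
  have hr : ∀ k, m k * Real.exp (x j - x k) = Real.exp (x j) * (m k * Real.exp (-x k)) := fun i => by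
    rw [show x j - x i = x j + -x i by ring, Real.exp_add]; ring
  have h1 : ∑ i ∈ Finset.Ico 1 j, m i * Real.exp (-|x j - x i|) = Real.exp (-x j) * A := by
    rw [hA, Finset.mul_sum]
    refine Finset.sum_congr rfl fun i hi => ?_
    rw [abs_of_pos (by linarith [hlt i hi]), neg_sub, hl]
  have h2 : ∑ k ∈ Finset.Ioc j n, m k * Real.exp (-|x j - x k|) = Real.exp (x j) * B := by
    rw [hB, Finset.mul_sum]
    refine Finset.sum_congr rfl fun i hi => ?_
    rw [abs_of_neg (by linarith [hgt i hi]), neg_neg, hr]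
  have h3 : ∑ i ∈ Finset.Ico 1 j, m i * expDerivLeft (x i) (x j) = -(Real.exp (-x j) * A) := by
    rw [hA, Finset.mul_sum, ← Finset.sum_neg_distrib]
    refine Finset.sum_congr rfl fun i hi => ?_
    rw [expDerivLeft, if_neg (hlt i hi).not_ge, mul_neg, hl]
  have h4 : ∑ k ∈ Finset.Ioc j n, m k * expDerivLeft (x k) (x j) = Real.exp (x j) * B := by
    rw [hB, Finset.mul_sum]
    refine Finset.sum_congr rfl fun i hi => ?_
    rw [expDerivLeft, if_pos (hgt i hi).le, hr]
  have h5 : ∑ i ∈ Finset.Ico 1 j, m i * expDeriv (x i) (x j) = -(Real.exp (-x j) * A) := by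
    rw [hA, Finset.mul_sum, ← Finset.sum_neg_distrib]
    refine Finset.sum_congr rfl fun i hi => ?_
    rw [expDeriv, if_neg (hlt i hi).not_gt, mul_neg, hl]
  have h6 : ∑ k ∈ Finset.Ioc j n, m k * expDeriv (x k) (x j) = Real.exp (x j) * B := by
    rw [hB, Finset.mul_sum]
    refine Finset.sum_congr rfl fun i hi => ?_
    rw [expDeriv, if_pos (hgt i hi), hr]
  rw [h1, h2, h3, h4, h5, h6]
  have hee : Real.exp (-x j) * Real.exp (x j) = 1 := by rw [← Real.exp_add]; simp
  simp only [expDeriv, expDerivLeft, lt_irrefl, le_refl, if_true, if_false, sub_self, abs_zero,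
    neg_zero, Real.exp_zero]
  linear_combination 4 * A * B * hee

end

/-- Ordered solutions of the peakon equations give distributional solutions of the mCH equation. -/
theorem isSolution_of_hasDerivAt {n : ℕ} {m : ℕ → ℝ} {x : ℝ → ℕ → ℝ}
    (hm : ∀ j ∈ Set.Icc 1 n, 0 < m j) (hx : ∀ t, StrictMonoOn (x t) (Set.Icc 1 n))
    (hd : ∀ t, ∀ j ∈ Set.Icc 1 n, HasDerivAt (fun s => x s j) (velocity n m (x t) j) t) :
    IsSolution fun y t => peakonProfile n m (x t) y := by
  refine ⟨fun t => continuous_peakonProfile _ _ _, fun t => peakonMeasure n m (x t),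
    fun y t => meanSq n m (x t) y, fun t => inferInstance, fun t => isMomentum_peakonProfile hm,
    fun t y => isMeanSqDeriv_peakonProfile _ _ _ _, fun ψ hψ t => ⟨integrable_peakonMeasure _, ?_⟩⟩
  simp only [integral_peakonMeasure hm]
  refine HasDerivAt.fun_sum fun j hj => ?_
  have hj := Finset.mem_Icc.1 hj
  rw [sq_sub_meanSq (hx t) hj, mul_comm (velocity _ _ _ _)]
  exact ((hψ.hasDerivAt _).comp t (hd t j hj)).const_mul _

end MCH

/-! ### Spectral data, positions and their ordering. -/

namespace MCH

open Filter Topology Polynomial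

/-! ### The spectral data -/

/-- The polynomial `∏ᵢ (y + ζᵢ)` without the factor for `i = j`. -/
noncomputable def cofactor (K : ℕ) (ζ : ℕ → ℝ) (j : ℕ) : ℝ[X] :=
  ∏ i ∈ (Finset.Icc 1 K).erase j, (X + C (ζ i))

/-- The pair `(P, Q)` with `Q / P = c + ∑ⱼ bⱼ / (y + ζⱼ)`. -/
noncomputable def spectralPair (K : ℕ) (ζ b : ℕ → ℝ) (c : ℝ) : ℝ[X] × ℝ[X] :=
  (∏ j ∈ Finset.Icc 1 K, (X + C (ζ j)),
    C c * ∏ j ∈ Finset.Icc 1 K, (X + C (ζ j)) + ∑ j ∈ Finset.Icc 1 K, C (b j) * cofactor K ζ j)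

section spectralPair

variable {K : ℕ} {ζ b : ℕ → ℝ} {c σ : ℝ}

theorem eval_spectralPair_fst (y : ℝ) {j : ℕ} (hj : j ∈ Finset.Icc 1 K) :
    (spectralPair K ζ b c).1.eval y = (y + ζ j) * (cofactor K ζ j).eval y := by
  rw [spectralPair, cofactor, ← Finset.mul_prod_erase _ _ hj]
  simp

theorem eval_spectralPair_snd (y : ℝ) : (spectralPair K ζ b c).2.eval y =
    c * (spectralPair K ζ b c).1.eval y + ∑ j ∈ Finset.Icc 1 K, b j * (cofactor K ζ j).eval y := by
  simp [spectralPair, eval_finsetSum]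

theorem eval_cofactor_pos (hσ : ∀ j ∈ Set.Icc 1 K, σ ≤ ζ j) {y : ℝ} (hy : -σ < y) (j : ℕ) :
    0 < (cofactor K ζ j).eval y := by
  rw [cofactor, eval_prod]
  refine Finset.prod_pos fun i hi => ?_
  have := hσ i (Finset.mem_Icc.1 (Finset.mem_of_mem_erase hi))
  simp only [eval_add, eval_X, eval_C]
  linarith

theorem eval_spectralPair_fst_pos (hσ : ∀ j ∈ Set.Icc 1 K, σ ≤ ζ j) {y : ℝ} (hy : -σ < y) :
    0 < (spectralPair K ζ b c).1.eval y := by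
  rw [spectralPair, eval_prod]
  refine Finset.prod_pos fun i hi => ?_
  have := hσ i (Finset.mem_Icc.1 hi)
  simp only [eval_add, eval_X, eval_C]
  linarith

theorem quot_spectralPair (hσ : ∀ j ∈ Set.Icc 1 K, σ ≤ ζ j) {y : ℝ} (hy : -σ < y) :
    quot y (spectralPair K ζ b c) = stieltjes K ζ b c y := by
  have hP := eval_spectralPair_fst_pos (b := b) (c := c) hσ hy
  rw [quot, eval_spectralPair_snd, add_div, mul_div_cancel_right₀ _ hP.ne', stieltjes,
    Finset.sum_div]
  congr 1
  refine Finset.sum_congr rfl fun j hj => ?_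
  have := eval_cofactor_pos hσ hy j
  rw [eval_spectralPair_fst y hj, mul_div_mul_right _ _ this.ne']

theorem degree_spectralPair_fst : (spectralPair K ζ b c).1.degree = K := by
  rw [spectralPair, degree_prod]
  simp

theorem degree_spectralPair_snd (hc : c ≠ 0) : (spectralPair K ζ b c).2.degree = K := by
  have h1 : (C c * (spectralPair K ζ b c).1).degree = K := by
    rw [degree_C_mul hc, degree_spectralPair_fst]
  have h2 : (∑ j ∈ Finset.Icc 1 K, C (b j) * cofactor K ζ j).degree < (K : WithBot ℕ) := by
    refine (degree_sum_le _ _).trans_lt ((Finset.sup_lt_iff (WithBot.bot_lt_coe K)).2 fun j hj => ?_)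
    refine (degree_mul_le _ _).trans_lt ?_
    have hcard : (cofactor K ζ j).degree = ((K - 1 : ℕ) : WithBot ℕ) := by
      rw [cofactor, degree_prod]
      simp [Finset.card_erase_of_mem hj]
    rw [hcard]
    have := Finset.mem_Icc.1 hj
    calc (C (b j)).degree + ((K - 1 : ℕ) : WithBot ℕ) ≤ 0 + ((K - 1 : ℕ) : WithBot ℕ) :=
          add_le_add_left degree_C_le _
      _ = ((K - 1 : ℕ) : WithBot ℕ) := zero_add _
      _ < K := by exact_mod_cast (by omega : K - 1 < K)
  rw [← h1] at h2
  exact (degree_add_eq_left_of_degree_lt h2).trans h1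

/-- The kernels are explicit sums of squares of `P` and the cofactors, with weights `b_j` and,
respectively, `c` and `b_j ζ_j`. Coprimality holds since `Q(-ζ_j) = b_j ∏_{i ≠ j} (ζ_i - ζ_j) ≠ 0`.
-/
theorem isStage_spectralPair (hσ0 : 0 < σ) (hσ : ∀ j ∈ Set.Icc 1 K, σ ≤ ζ j)
    (hζ : Set.InjOn ζ (Set.Icc 1 K)) (hb : ∀ j ∈ Set.Icc 1 K, 0 < b j) (hc : 0 < c) :
    IsStage σ (2 * K + 1) (spectralPair K ζ b c) := by
  have hmem : ∀ {j}, j ∈ Finset.Icc 1 K → j ∈ Set.Icc 1 K := fun hj => Finset.mem_Icc.1 hj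
  refine ⟨fun y hy => eval_spectralPair_fst_pos hσ hy, fun _ y hy => ?_, ?_, ?_, ?_, ?_, ?_⟩
  · rw [eval_spectralPair_snd]
    exact add_pos_of_pos_of_nonneg (mul_pos hc (eval_spectralPair_fst_pos hσ hy))
      (Finset.sum_nonneg fun j hj => (mul_pos (hb j (hmem hj)) (eval_cofactor_pos hσ hy j)).le)
  · refine ⟨_, IsSqKernel.sum (Finset.Icc 1 K) fun j hj =>
      (IsSqKernel.of_mul (cofactor K ζ j)).const_mul (hb j (hmem hj)).le, fun x y => ?_⟩
    rw [eval_spectralPair_snd, eval_spectralPair_snd, Finset.mul_sum, mul_add, add_mul,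
      Finset.mul_sum, Finset.sum_mul, mul_left_comm, mul_assoc, add_sub_add_left_eq_sub,
      ← Finset.sum_sub_distrib]
    refine Finset.sum_congr rfl fun j hj => ?_
    rw [eval_spectralPair_fst x hj, eval_spectralPair_fst y hj]
    ring
  · refine ⟨_, ((IsSqKernel.of_mul (spectralPair K ζ b c).1).const_mul hc.le).add
      (IsSqKernel.sum (Finset.Icc 1 K) fun j hj => (IsSqKernel.of_mul (cofactor K ζ j)).const_mul
      (mul_pos (hb j (hmem hj)) (hσ0.trans_le (hσ j (hmem hj)))).le), fun x y => ?_⟩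
    have h1 : ∑ j ∈ Finset.Icc 1 K, (x - y) *
        (b j * ζ j * ((cofactor K ζ j).eval x * (cofactor K ζ j).eval y)) =
        x * (∑ j ∈ Finset.Icc 1 K, b j * (cofactor K ζ j).eval x) *
          (spectralPair K ζ b c).1.eval y -
        y * (∑ j ∈ Finset.Icc 1 K, b j * (cofactor K ζ j).eval y) *
          (spectralPair K ζ b c).1.eval x := by
      rw [Finset.mul_sum, Finset.mul_sum, Finset.sum_mul, Finset.sum_mul, ← Finset.sum_sub_distrib]
      refine Finset.sum_congr rfl fun j hj => ?_
      rw [eval_spectralPair_fst x hj, eval_spectralPair_fst y hj]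
      ring
    rw [← Finset.mul_sum] at h1
    rw [eval_spectralPair_snd, eval_spectralPair_snd]
    linear_combination -h1
  · refine IsCoprime.prod_left fun j hj => ?_
    have hroot : (spectralPair K ζ b c).2.eval (-ζ j) ≠ 0 := by
      rw [eval_spectralPair_snd, eval_spectralPair_fst _ hj, neg_add_cancel, zero_mul, mul_zero,
        zero_add, Finset.sum_eq_single_of_mem j hj]
      · refine mul_ne_zero (hb j (hmem hj)).ne' ?_
        rw [cofactor, eval_prod]
        refine Finset.prod_ne_zero_iff.2 fun i hi => ?_
        simp only [eval_add, eval_X, eval_C]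
        intro h0
        have := hζ (hmem (Finset.mem_of_mem_erase hi)) (hmem hj) (by linarith)
        exact Finset.ne_of_mem_erase hi this
      · intro i _ hij
        rw [cofactor, ← Finset.mul_prod_erase _ _ (Finset.mem_erase.2 ⟨hij.symm, hj⟩)]
        simp
    have hirr : Irreducible (X + C (ζ j)) := by
      simpa using irreducible_X_sub_C (-ζ j)
    refine hirr.coprime_iff_not_dvd.2 fun hdvd => hroot ?_
    have : X - C (-ζ j) ∣ (spectralPair K ζ b c).2 := by simpa using hdvd
    exact dvd_iff_isRoot.1 this
  · intro r hr
    omega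
  · intro r hr
    obtain rfl : K = r := by omega
    exact ⟨degree_spectralPair_snd hc.ne', degree_spectralPair_fst.le⟩

theorem natDegree_spectralPair (hc : c ≠ 0) : (spectralPair K ζ b c).1.natDegree ≤ K ∧
    (spectralPair K ζ b c).2.natDegree ≤ K :=
  ⟨natDegree_le_of_degree_le degree_spectralPair_fst.le,
    natDegree_le_of_degree_le (degree_spectralPair_snd hc).le⟩

theorem evolves_spectralPair (hσ0 : 0 < σ) (hσ : ∀ j ∈ Set.Icc 1 K, σ ≤ ζ j) (hc : c ≠ 0)
    (t : ℝ) :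
    Evolves K (fun s => spectralPair K ζ (fun j => b j * Real.exp (2 * s / ζ j)) c) 0 t := by
  refine ⟨fun s => (natDegree_spectralPair hc).1, fun s => (natDegree_spectralPair hc).2,
    fun y _ => ?_, fun y hy => ?_⟩
  · simpa [spectralPair] using hasDerivAt_const t (eval y (∏ j ∈ Finset.Icc 1 K, (X + C (ζ j))))
  · have hconst : ∀ s, (spectralPair K ζ (fun j => b j * Real.exp (2 * s / ζ j)) c).1 =
      (spectralPair K ζ b c).1 := fun s => rfl
    rw [quot_spectralPair hσ (by linarith)]
    simp only [eval_spectralPair_snd, hconst]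
    have hder : HasDerivAt (fun s => ∑ j ∈ Finset.Icc 1 K,
        b j * Real.exp (2 * s / ζ j) * (cofactor K ζ j).eval y)
        (∑ j ∈ Finset.Icc 1 K, b j * (Real.exp (2 * t / ζ j) * (2 / ζ j)) *
          (cofactor K ζ j).eval y) t := by
      refine HasDerivAt.fun_sum fun j _ => ?_
      have h1 : HasDerivAt (fun s => 2 * s / ζ j) (2 / ζ j) t := by
        simpa using ((hasDerivAt_id t).const_mul 2).div_const (ζ j)
      exact (h1.exp.const_mul _).mul_const _
    refine (hder.const_add _).congr_deriv ?_
    rw [stieltjes]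
    simp only [zero_add, mul_zero, add_zero]
    -- Partial fractions: `2 / ζ = -2 / y + 2 (y + ζ) / (y ζ)`.
    have h2 : ∀ j ∈ Finset.Icc 1 K, b j * (Real.exp (2 * t / ζ j) * (2 / ζ j)) *
        (cofactor K ζ j).eval y = -2 / y * (b j * Real.exp (2 * t / ζ j) *
          (cofactor K ζ j).eval y) + 2 / y * (b j * Real.exp (2 * t / ζ j) / ζ j) *
          (spectralPair K ζ b c).1.eval y := by
      intro j hj
      have := hσ0.trans_le (hσ j (Finset.mem_Icc.1 hj))
      rw [eval_spectralPair_fst y hj]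
      field_simp
      ring
    rw [Finset.sum_congr rfl h2, Finset.sum_add_distrib, ← Finset.mul_sum, ← Finset.sum_mul,
      ← Finset.mul_sum]
    ring

end spectralPair

/-! ### The inverse formulas -/

theorem inverseFormula_eq_log_detRatio (K : ℕ) (m ζ b : ℕ → ℝ) (c : ℝ) (k : ℕ) :
    inverseFormula K m ζ b c (k + 1) =
      Real.log (detRatio k (fun i => nodes (2 * K + 1) m (i + 1))
        (fun i => stieltjes K ζ b c (nodes (2 * K + 1) m (i + 1))) /
          m (prime (2 * K + 1) (k + 1))) := by
  have hE : ∏ j ∈ Finset.Icc 1 (k + 1 - 1), nodes (2 * K + 1) m j =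
      ∏ j ∈ Finset.range k, nodes (2 * K + 1) m (j + 1) := by
    rw [Nat.add_sub_cancel, ← Finset.Ico_add_one_right_eq_Icc, Finset.prod_Ico_eq_prod_range]
    simp [add_comm]
  rw [detRatio, ← abs_det_csv_eq_csvA, ← abs_det_csv_eq_csvA, ← abs_det_csv_eq_csvB,
    ← abs_det_csv_eq_csvB, inverseFormula, hE]
  simp only [Nat.add_sub_cancel]
  simp only [detCSV]
  rw [div_div]
  split_ifs with h
  · have h1 : (k + 1) / 2 = k / 2 := by rw [Nat.odd_iff] at h; omega
    rw [h1]
    congr 1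
    ring
  · have h1 : (k + 1 + 1) / 2 = (k + 1) / 2 := by rw [Nat.not_odd_iff] at h; omega
    have h2 : (k + 1) / 2 - 1 = k / 2 := by rw [Nat.not_odd_iff] at h; omega
    rw [h1, h2]
    congr 1
    ring

theorem nodes_pos {n : ℕ} {m : ℕ → ℝ} (hm : ∀ j ∈ Set.Icc 1 n, 0 < m j) {i : ℕ} (hi : i < n) :
    0 < nodes n m (i + 1) := by
  have := hm (prime n (i + 1)) ⟨by unfold prime; omega, by unfold prime; omega⟩
  unfold nodes
  positivity

/-- The value `h` of the `i`-th removed peakon, `i = 0, 1, …`. -/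
noncomputable def peelValue (n : ℕ) (m : ℕ → ℝ) (s : ℝ[X] × ℝ[X]) (i : ℕ) : ℝ :=
  quot (nodes n m (i + 1)) (stage (fun j => nodes n m (j + 1)) s i)

section

variable {K : ℕ} {m ζ b : ℕ → ℝ} {c σ : ℝ}

theorem inverseFormula_eq_log_peelValue (hσ0 : 0 < σ) (hσ : ∀ j ∈ Set.Icc 1 K, σ ≤ ζ j)
    (hζ : Set.InjOn ζ (Set.Icc 1 K)) (hb : ∀ j ∈ Set.Icc 1 K, 0 < b j) (hc : 0 < c)
    (hm : m ∈ distinctMasses (2 * K + 1)) {k : ℕ} (hk : k < 2 * K + 1) :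
    inverseFormula K m ζ b c (k + 1) = Real.log (peelValue (2 * K + 1) m (spectralPair K ζ b c) k /
      m (prime (2 * K + 1) (k + 1))) := by
  obtain ⟨hpos, hinj⟩ := hm
  have hst := isStage_spectralPair hσ0 hσ hζ hb hc
  obtain ⟨l, hl⟩ : ∃ l, 2 * K + 1 = l + k + 1 := ⟨2 * K - k, by omega⟩
  have ha : ∀ i ≤ k, 0 < nodes (2 * K + 1) m (i + 1) := fun i hi => nodes_pos hpos (by omega)
  rw [inverseFormula_eq_log_detRatio, peelValue,
    quot_stage_eq_detRatio (a := fun i => nodes (2 * K + 1) m (i + 1)) (l := l) hσ0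
      (by rwa [hl] at hst) ha]
  · congr 2
    exact detRatio_congr fun i hi =>
      (quot_spectralPair hσ (by linarith [ha i hi])).symm
  · intro i hi j hj hij
    have hi := Set.mem_Iic.1 hi
    have hj := Set.mem_Iic.1 hj
    have hi' : prime (2 * K + 1) (i + 1) ∈ Set.Icc 1 (2 * K + 1) :=
      ⟨by unfold prime; omega, by unfold prime; omega⟩
    have hj' : prime (2 * K + 1) (j + 1) ∈ Set.Icc 1 (2 * K + 1) :=
      ⟨by unfold prime; omega, by unfold prime; omega⟩
    have h1 := hpos _ hi'
    have h2 := hpos _ hj'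
    have h3 : m (prime (2 * K + 1) (i + 1)) = m (prime (2 * K + 1) (j + 1)) := by
      simp only [nodes, one_div, inv_inj] at hij
      exact (pow_left_inj₀ h1.le h2.le two_ne_zero).1 hij
    have := hinj hi' hj' h3
    unfold prime at this
    omega

/-- The removal procedure is continuous at every positive `m` and agrees with the determinants on
distinct masses. -/
theorem isPosition_log_peelValue (hσ0 : 0 < σ) (hσ : ∀ j ∈ Set.Icc 1 K, σ ≤ ζ j)
    (hζ : Set.InjOn ζ (Set.Icc 1 K)) (hb : ∀ j ∈ Set.Icc 1 K, 0 < b j) (hc : 0 < c)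
    (hm : ∀ j ∈ Set.Icc 1 (2 * K + 1), 0 < m j) {k : ℕ} (hk : k < 2 * K + 1) :
    IsPosition K m ζ b c (k + 1) (Real.log (peelValue (2 * K + 1) m (spectralPair K ζ b c) k /
      m (prime (2 * K + 1) (k + 1)))) := by
  have hst := isStage_spectralPair hσ0 hσ hζ hb hc
  obtain ⟨l, hl⟩ : ∃ l, 2 * K + 1 = l + 1 + k := ⟨2 * K - k, by omega⟩
  have hst' := hst
  rw [hl] at hst'
  have hnodes : ∀ j ≤ k, Tendsto (fun m' : ℕ → ℝ => nodes (2 * K + 1) m' (j + 1))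
      (𝓝[distinctMasses (2 * K + 1)] m) (𝓝 (nodes (2 * K + 1) m (j + 1))) := by
    intro j hj
    have hp := hm (prime (2 * K + 1) (j + 1)) ⟨by unfold prime; omega, by unfold prime; omega⟩
    refine Tendsto.mono_left ?_ nhdsWithin_le_nhds
    exact tendsto_const_nhds.div (((continuous_apply _).tendsto m).pow 2) (by positivity)
  have hpos : ∀ j ≤ k, 0 < nodes (2 * K + 1) m (j + 1) := fun j hj => nodes_pos hm (by omega)
  have hlast := (hst'.stage hσ0 (a := fun j => nodes (2 * K + 1) m (j + 1))
    fun j hj => hpos j hj.le)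
  have hmp := hm (prime (2 * K + 1) (k + 1)) ⟨by unfold prime; omega, by unfold prime; omega⟩
  have hq : 0 < peelValue (2 * K + 1) m (spectralPair K ζ b c) k :=
    hlast.quot_pos (by linarith [hpos k le_rfl])
  have htend := (stageTendsto_stage (natDegree_spectralPair hc.ne').1
    (natDegree_spectralPair hc.ne').2 hσ0 hst' (fun j hj => hnodes j hj.le)
    fun j hj => hpos j hj.le).tendsto_quot (hnodes k le_rfl)
    (hlast.fst_pos _ (by linarith [hpos k le_rfl])).ne'
  have hmt : Tendsto (fun m' : ℕ → ℝ => m' (prime (2 * K + 1) (k + 1)))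
      (𝓝[distinctMasses (2 * K + 1)] m) (𝓝 (m (prime (2 * K + 1) (k + 1)))) :=
    ((continuous_apply _).tendsto m).mono_left nhdsWithin_le_nhds
  refine Tendsto.congr' ?_ ((htend.div hmt hmp.ne').log (div_pos hq hmp).ne')
  filter_upwards [self_mem_nhdsWithin] with m' hm'
  exact (inverseFormula_eq_log_peelValue hσ0 hσ hζ hb hc hm' hk).symm

end

/-! ### Peakon trajectories -/

/-- The position of the `j`-th peakon for the pair `(P, Q)`. -/
noncomputable def peelPosition (n : ℕ) (m : ℕ → ℝ) (s : ℝ[X] × ℝ[X]) (j : ℕ) : ℝ :=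
  Real.log (peelValue n m s (n - j) / m j)

/-- Peakon `j` is removed at step `n - j`, counted from zero, so sums over peakons to its left
become sums over later steps. -/
theorem sum_Ico_reflect (n : ℕ) {j : ℕ} (hj : j ∈ Set.Icc 1 n) (f : ℕ → ℝ) :
    ∑ i ∈ Finset.Ico 1 j, f (n - i) = ∑ p ∈ Finset.Ico (n - j + 1) n, f p := by
  have := hj.2
  refine Finset.sum_nbij' (n - ·) (n - ·) ?_ ?_ ?_ ?_ ?_ <;>
    intro i hi <;> simp only [Finset.mem_Ico] at * <;> omega

theorem sum_Ioc_reflect (n j : ℕ) (f : ℕ → ℝ) :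
    ∑ i ∈ Finset.Ioc j n, f (n - i) = ∑ p ∈ Finset.range (n - j), f p := by
  refine Finset.sum_nbij' (n - ·) (n - ·) ?_ ?_ ?_ ?_ ?_ <;>
    intro i hi <;> simp only [Finset.mem_Ioc, Finset.mem_range] at * <;> omega

section

variable {n : ℕ} {m : ℕ → ℝ} {s : ℝ[X] × ℝ[X]} {σ : ℝ}

theorem isStage_stage_nodes (hσ : 0 < σ) (hm : ∀ j ∈ Set.Icc 1 n, 0 < m j) (hs : IsStage σ n s)
    {i : ℕ} (hi : i ≤ n) :
    IsStage σ (n - i) (stage (fun j => nodes n m (j + 1)) s i) :=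
  IsStage.stage hσ (by rwa [Nat.sub_add_cancel hi]) fun _ hj => nodes_pos hm (by omega)

theorem peelValue_pos (hσ : 0 < σ) (hm : ∀ j ∈ Set.Icc 1 n, 0 < m j) (hs : IsStage σ n s)
    {i : ℕ} (hi : i < n) : 0 < peelValue n m s i := by
  have h := isStage_stage_nodes hσ hm hs hi.le
  obtain ⟨l, hl⟩ : ∃ l, n - i = l + 1 := ⟨n - i - 1, by omega⟩
  rw [hl] at h
  exact h.quot_pos (by linarith [nodes_pos hm hi])

theorem mul_exp_peelPosition (hσ : 0 < σ) (hm : ∀ j ∈ Set.Icc 1 n, 0 < m j) (hs : IsStage σ n s)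
    {j : ℕ} (hj : j ∈ Set.Icc 1 n) :
    m j * Real.exp (peelPosition n m s j) = peelValue n m s (n - j) := by
  have h1 := hm j hj
  have h2 := peelValue_pos hσ hm hs (i := n - j) (by have := hj.1; have := hj.2; omega)
  rw [peelPosition, Real.exp_log (by positivity)]
  field_simp

theorem mul_exp_neg_peelPosition (hσ : 0 < σ) (hm : ∀ j ∈ Set.Icc 1 n, 0 < m j)
    (hs : IsStage σ n s) {j : ℕ} (hj : j ∈ Set.Icc 1 n) :
    m j * Real.exp (-peelPosition n m s j) =
      1 / (nodes n m (n - j + 1) * peelValue n m s (n - j)) := by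
  have h1 := hm j hj
  have h2 := peelValue_pos hσ hm hs (i := n - j) (by have := hj.1; have := hj.2; omega)
  have h3 : prime n (n - j + 1) = j := by
    have := hj.1; have := hj.2; unfold prime; omega
  rw [peelPosition, Real.exp_neg, Real.exp_log (by positivity), nodes, h3]
  field_simp

/-- At `y = 0` each removal lowers `Q / P` by `h`, and `Q = 0` after the last one. -/
theorem quot_zero_stage (hσ : 0 < σ) (hm : ∀ j ∈ Set.Icc 1 n, 0 < m j) (hs : IsStage σ n s)
    {i : ℕ} (hi : i ≤ n) : quot 0 (stage (fun j => nodes n m (j + 1)) s i) =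
      ∑ p ∈ Finset.Ico i n, peelValue n m s p := by
  induction hi using Nat.decreasingInduction with
  | self =>
    have h := (isStage_stage_nodes hσ hm hs le_rfl).degree_even 0 (by simp)
    have h0 : (stage (fun j => nodes n m (j + 1)) s n).2 = 0 := by
      have := h.2
      rwa [Nat.cast_zero, ← not_le, zero_le_degree_iff, not_not] at this
    simp [quot, h0]
  | of_succ k hk ih =>
    have h := isStage_stage_nodes hσ hm hs hk.le
    obtain ⟨l, hl⟩ : ∃ l, n - k = l + 1 := ⟨n - k - 1, by omega⟩
    rw [hl] at h
    rw [stage, Evolves.quot_zero_strip h hσ (nodes_pos hm hk)] at ih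
    rw [Finset.sum_eq_sum_Ico_succ_bot hk, ← ih, peelValue]
    ring

/-- Let `h` and `h'` belong to peakons `j + 1` and `j`. With `1 / (m_j m_{j+1}) < τ < σ`, the bound
`h' < h / (m_{j+1}² τ)` gives `h' / m_j < h / m_{j+1}`. -/
theorem peelPosition_lt_succ (hσ : 0 < σ) (hm : ∀ j ∈ Set.Icc 1 n, 0 < m j)
    (hs : IsStage σ n s) {j : ℕ} (hj : 1 ≤ j) (hjn : j + 1 ≤ n)
    (hlt : 1 / (m j * m (j + 1)) < σ) :
    peelPosition n m s j < peelPosition n m s (j + 1) := by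
  have h1 := hm j ⟨hj, by omega⟩
  have h2 := hm (j + 1) ⟨by omega, hjn⟩
  obtain ⟨l, hl⟩ : ∃ l, n = l + (j + 1) := ⟨n - (j + 1), by omega⟩
  have e1 : n - j = l + 1 := by omega
  have e2 : n - (j + 1) = l := by omega
  have hl1 : l + 1 < n := by omega
  have h3 := peelValue_pos hσ hm hs hl1
  have h4 := peelValue_pos hσ hm hs (i := l) (by omega)
  have hst := isStage_stage_nodes hσ hm hs (i := l) (by omega)
  obtain ⟨r, hr⟩ : ∃ r, n - l = r + 2 := ⟨j - 1, by omega⟩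
  rw [hr] at hst
  rw [peelPosition, peelPosition, e1, e2]
  refine Real.log_lt_log (by positivity) ?_
  obtain ⟨τ, hτ1, hτ2⟩ := exists_between hlt
  have hτ : 0 < τ := lt_trans (by positivity) hτ1
  have hb := hst.quot_strip_lt (nodes_pos hm (i := l) (by omega)) hτ hτ2
    (nodes_pos hm hl1)
  change peelValue n m s (l + 1) < nodes n m (l + 1) * peelValue n m s l / τ at hb
  have hp : prime n (l + 1) = j + 1 := by unfold prime; omega
  rw [nodes, hp, lt_div_iff₀ hτ] at hb
  rw [div_lt_div_iff₀ h1 h2]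
  rw [div_lt_iff₀ (by positivity)] at hτ1
  have h5 : peelValue n m s (l + 1) * τ * m (j + 1) ^ 2 < peelValue n m s l := by
    calc _ < 1 / m (j + 1) ^ 2 * peelValue n m s l * m (j + 1) ^ 2 :=
          mul_lt_mul_of_pos_right hb (by positivity)
      _ = _ := by field_simp
  have h6 : peelValue n m s (l + 1) * m (j + 1) <
      peelValue n m s (l + 1) * m (j + 1) * (τ * (m j * m (j + 1))) :=
    lt_mul_of_one_lt_right (by positivity) hτ1
  calc _ < _ := h6
    _ = (peelValue n m s (l + 1) * τ * m (j + 1) ^ 2) * m j := by ring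
    _ < _ := mul_lt_mul_of_pos_right h5 h1

theorem evolves_stage (hσ : 0 < σ) (hm : ∀ j ∈ Set.Icc 1 n, 0 < m j) {N : ℕ}
    {f : ℝ → ℝ[X] × ℝ[X]} (hf : ∀ t, IsStage σ n (f t)) {t : ℝ} (he : Evolves N f 0 t) {i : ℕ}
    (hi : i ≤ n) : Evolves N (fun s => stage (fun j => nodes n m (j + 1)) (f s) i)
      (∑ p ∈ Finset.range i, 1 / (nodes n m (p + 1) * peelValue n m (f t) p)) t := by
  induction i with
  | zero => simpa [stage] using he
  | succ i ih =>
    rw [Finset.sum_range_succ]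
    obtain ⟨l, hl⟩ : ∃ l, n - i = l + 1 := ⟨n - i - 1, by omega⟩
    exact (ih (by omega)).strip hσ (l := l)
      (fun s => by simpa [hl] using isStage_stage_nodes hσ hm (hf s) (i := i) (by omega))
      (nodes_pos hm hi)

/-- When peakon `j` is about to be removed, `H` is the sum of `m_i e^{x_i}` over `i ≤ j` and `Γ` the
sum of `m_k e^{-x_k}` over `k > j`; the ordering turns the velocity into the same expression. -/
theorem hasDerivAt_peelPosition (hσ : 0 < σ) (hm : ∀ j ∈ Set.Icc 1 n, 0 < m j) {N : ℕ}
    {f : ℝ → ℝ[X] × ℝ[X]} (hf : ∀ t, IsStage σ n (f t)) {t : ℝ} (he : Evolves N f 0 t)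
    (hx : StrictMonoOn (peelPosition n m (f t)) (Set.Icc 1 n)) {j : ℕ} (hj : j ∈ Set.Icc 1 n) :
    HasDerivAt (fun s => peelPosition n m (f s) j) (velocity n m (peelPosition n m (f t)) j) t := by
  have hj1 := hj.1
  have hj2 := hj.2
  have hlt : n - j < n := by omega
  have hmj := hm j hj
  have hev := evolves_stage hσ hm hf he hlt.le
  have hst := isStage_stage_nodes hσ hm (hf t) hlt.le
  obtain ⟨l, hl⟩ : ∃ l, n - (n - j) = l + 1 := ⟨j - 1, by omega⟩
  rw [hl] at hst
  have hd := hev.hasDerivAt_quot hσ hst (nodes_pos hm hlt)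
  have hpv := peelValue_pos hσ hm (hf t) hlt
  refine ((hd.div_const (m j)).log (div_pos hpv hmj).ne').congr_deriv ?_
  rw [velocity_eq hx hj, mul_exp_peelPosition hσ hm (hf t) hj,
    mul_exp_neg_peelPosition hσ hm (hf t) hj]
  have hA : ∑ i ∈ Finset.Ico 1 j, m i * Real.exp (peelPosition n m (f t) i) =
      ∑ p ∈ Finset.Ico (n - j + 1) n, peelValue n m (f t) p := by
    rw [← sum_Ico_reflect n hj]
    refine Finset.sum_congr rfl fun i hi => mul_exp_peelPosition hσ hm (hf t) ?_
    rw [Finset.mem_Ico] at hi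
    exact ⟨hi.1, by omega⟩
  have hB : ∑ i ∈ Finset.Ioc j n, m i * Real.exp (-peelPosition n m (f t) i) =
      ∑ p ∈ Finset.range (n - j), 1 / (nodes n m (p + 1) * peelValue n m (f t) p) := by
    rw [← sum_Ioc_reflect n j fun p => 1 / (nodes n m (p + 1) * peelValue n m (f t) p)]
    refine Finset.sum_congr rfl fun i hi => mul_exp_neg_peelPosition hσ hm (hf t) ?_
    rw [Finset.mem_Ioc] at hi
    exact ⟨by omega, hi.2⟩
  rw [hA, hB, quot_zero_stage hσ hm (hf t) hlt.le, Finset.sum_eq_sum_Ico_succ_bot hlt]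
  change (peelValue n m (f t) (n - j) * (2 * (1 / (nodes n m (n - j + 1) *
    peelValue n m (f t) (n - j))) * (_ - peelValue n m (f t) (n - j)) +
    2 * _ * (2 * _ - peelValue n m (f t) (n - j)))) / m j /
    (peelValue n m (f t) (n - j) / m j) = _
  rw [div_div_div_cancel_right₀ hmj.ne', mul_div_cancel_left₀ _ hpv.ne']
  ring

end

/-! ### The sufficient conditions -/

/-- For `k = 2r + 1` the value is `ζ₁ (ζ₁ / ζ_K)^r`. -/
theorem alpha_le {K : ℕ} {ζ : ℕ → ℝ} (hζ_pos : ∀ j ∈ Set.Icc 1 K, 0 < ζ j)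
    (hζ_lt : StrictMonoOn ζ (Set.Icc 1 K)) (hK : 1 ≤ K) {k : ℕ} (hk : Odd k) :
    0 ≤ alpha K ζ k ∧ alpha K ζ k ≤ ζ 1 := by
  have h1 := hζ_pos 1 ⟨le_rfl, hK⟩
  have h2 := hζ_pos K ⟨hK, le_rfl⟩
  have h3 : ζ 1 ≤ ζ K := hζ_lt.monotoneOn ⟨le_rfl, hK⟩ ⟨hK, le_rfl⟩ hK
  refine ⟨by unfold alpha; positivity, ?_⟩
  obtain ⟨r, rfl⟩ := hk
  rw [alpha, show (2 * r + 1 + 1) / 2 = r + 1 by omega, show (2 * r + 1 - 1) / 2 = r by omega,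
    div_le_iff₀ (by positivity), pow_succ, mul_comm]
  exact mul_le_mul_of_nonneg_left (pow_le_pow_left₀ h1.le h3 r) h1.le

theorem lt_of_lt_mul_min {x a z : ℝ} {β : EReal} (ha : 0 ≤ a) (haz : a ≤ z)
    (h : (x : EReal) < (a : EReal) * min 1 β) : x < z := by
  have h1 : (a : EReal) * min 1 β ≤ (a : EReal) * 1 :=
    mul_le_mul_of_nonneg_left (min_le_left _ _) (by exact_mod_cast ha)
  rw [mul_one] at h1
  exact (EReal.coe_lt_coe_iff.1 (h.trans_le h1)).trans_le haz

end MCH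

/-! ### The main theorem. -/

theorem theorem6p4 (K : ℕ) (m ζ b : ℕ → ℝ) (c : ℝ)
    (hm : ∀ j ∈ Set.Icc 1 (2 * K + 1), 0 < m j)
    (hb : ∀ j ∈ Set.Icc 1 K, 0 < b j)
    (hζ_pos : ∀ j ∈ Set.Icc 1 K, 0 < ζ j)
    (hζ_lt : StrictMonoOn ζ (Set.Icc 1 K))
    (hc : 0 < c)
    (h_first : ∀ k : ℕ, Odd k → 1 ≤ k → k ≤ 2 * K - 1 →
      ((1 / (m (MCH.prime (2 * K + 1) (k + 1)) * m (MCH.prime (2 * K + 1) k)) : ℝ) : EReal) <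
        (MCH.alpha K ζ k : EReal) * min 1 (MCH.betaHat K m ζ k))
    (h_second : ∀ k : ℕ, Odd k → 1 ≤ k → k ≤ 2 * K - 1 →
      ((1 / (m (MCH.prime (2 * K + 1) (k + 2)) * m (MCH.prime (2 * K + 1) (k + 1))) : ℝ) : EReal) <
        (MCH.alpha K ζ k : EReal) * min 1 (MCH.betaHatOne K m ζ k)) :
    ∃ x : ℝ → ℕ → ℝ,
      -- the positions are given by the inverse formulas with `b_j(t) = b_j e^{2t/ζ_j}`
      (∀ t : ℝ, ∀ k ∈ Set.Icc 1 (2 * K + 1),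
        MCH.IsPosition K m ζ (fun j => b j * Real.exp (2 * t / ζ j)) c k
          (x t (MCH.prime (2 * K + 1) k))) ∧
      -- they are ordered at all times
      (∀ t : ℝ, StrictMonoOn (x t) (Set.Icc 1 (2 * K + 1))) ∧
      -- they solve the peakon equations at all times
      (∀ t : ℝ, ∀ j ∈ Set.Icc 1 (2 * K + 1),
        HasDerivAt (fun s => x s j) (MCH.velocity (2 * K + 1) m (x t) j) t) ∧
      -- the multipeakon function is a global distributional solution of the mCH equation
      MCH.IsSolution (fun y t => MCH.peakonProfile (2 * K + 1) m (x t) y) := by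
  -- The spectral gap is `ζ₁`; for `K = 0` there is no spectrum and no neighbouring pair, so any
  -- positive number serves.
  obtain ⟨σ, hσ0, hσ, hσK⟩ : ∃ σ : ℝ, 0 < σ ∧ (∀ j ∈ Set.Icc 1 K, σ ≤ ζ j) ∧
      (1 ≤ K → σ = ζ 1) := by
    rcases Nat.eq_zero_or_pos K with rfl | hK
    · exact ⟨1, one_pos, fun j hj => by have := hj.1; have := hj.2; omega, by omega⟩
    · exact ⟨ζ 1, hζ_pos 1 ⟨le_rfl, hK⟩, fun j hj =>
        hζ_lt.monotoneOn ⟨le_rfl, hK⟩ hj hj.1, fun _ => rfl⟩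
  have hgap : ∀ j, 1 ≤ j → j + 1 ≤ 2 * K + 1 → 1 / (m j * m (j + 1)) < σ := by
    intro j hj hjn
    rw [hσK (by omega)]
    -- Neighbours `j, j + 1` with `j` even come from the first family at `k = 2K + 1 - j`, those
    -- with `j` odd from the second at `k = 2K - j`.
    rcases Nat.even_or_odd' j with ⟨r, rfl | rfl⟩
    · have hodd : Odd (2 * K + 1 - 2 * r) := ⟨K - r, by omega⟩
      have h := h_first _ hodd (by omega) (by omega)
      rw [show MCH.prime (2 * K + 1) (2 * K + 1 - 2 * r + 1) = 2 * r by unfold MCH.prime; omega,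
        show MCH.prime (2 * K + 1) (2 * K + 1 - 2 * r) = 2 * r + 1 by unfold MCH.prime; omega] at h
      obtain ⟨h1, h2⟩ := MCH.alpha_le hζ_pos hζ_lt (by omega) hodd
      exact MCH.lt_of_lt_mul_min h1 h2 h
    · have hodd : Odd (2 * K - (2 * r + 1)) := ⟨K - r - 1, by omega⟩
      have h := h_second _ hodd (by omega) (by omega)
      rw [show MCH.prime (2 * K + 1) (2 * K - (2 * r + 1) + 2) = 2 * r + 1 by
          unfold MCH.prime; omega,
        show MCH.prime (2 * K + 1) (2 * K - (2 * r + 1) + 1) = 2 * r + 1 + 1 by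
          unfold MCH.prime; omega] at h
      obtain ⟨h1, h2⟩ := MCH.alpha_le hζ_pos hζ_lt (by omega) hodd
      exact MCH.lt_of_lt_mul_min h1 h2 h
  set s : ℝ → Polynomial ℝ × Polynomial ℝ :=
    fun t => MCH.spectralPair K ζ (fun j => b j * Real.exp (2 * t / ζ j)) c
  have hbt : ∀ t : ℝ, ∀ j ∈ Set.Icc 1 K, 0 < b j * Real.exp (2 * t / ζ j) := fun t j hj =>
    mul_pos (hb j hj) (Real.exp_pos _)
  have hst : ∀ t, MCH.IsStage σ (2 * K + 1) (s t) := fun t =>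
    MCH.isStage_spectralPair hσ0 hσ hζ_lt.injOn (hbt t) hc
  have hmono : ∀ t, StrictMonoOn (MCH.peelPosition (2 * K + 1) m (s t))
      (Set.Icc 1 (2 * K + 1)) := fun t =>
    strictMonoOn_of_lt_succ Set.ordConnected_Icc fun j _ hj hj' =>
      MCH.peelPosition_lt_succ hσ0 hm (hst t) hj.1 hj'.2 (hgap j hj.1 hj'.2)
  have hder := fun t j hj => MCH.hasDerivAt_peelPosition hσ0 hm hst
    (MCH.evolves_spectralPair hσ0 hσ hc.ne' t) (hmono t) (j := j) hj
  refine ⟨fun t => MCH.peelPosition (2 * K + 1) m (s t), fun t k hk => ?_, hmono, hder,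
    MCH.isSolution_of_hasDerivAt hm hmono hder⟩
  obtain ⟨hk1, hk2⟩ := hk
  obtain ⟨k, rfl⟩ := Nat.exists_eq_succ_of_ne_zero (Nat.one_le_iff_ne_zero.1 hk1)
  have := MCH.isPosition_log_peelValue hσ0 hσ hζ_lt.injOn (hbt t) hc hm (k := k) (by omega)
  have hpos : MCH.peelPosition (2 * K + 1) m (s t) (MCH.prime (2 * K + 1) (k + 1)) =
      Real.log (MCH.peelValue (2 * K + 1) m (s t) k / m (MCH.prime (2 * K + 1) (k + 1))) := by
    rw [MCH.peelPosition,
      show 2 * K + 1 - MCH.prime (2 * K + 1) (k + 1) = k by unfold MCH.prime; omega]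
  rw [← hpos] at this
  exact this
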